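/- All graphs are finite and simple. A constraint graph is a pair $(G,X)$ consisting of a graph $G$ and a set $X\subseteq E(G)$. It is 3-connected if $G$ is 3-connected, i.e. $G$ has at least four vertices and $G-S$ is connected for every set $S$ of at most two vertices. The set $X$ is a connected edge set in $G$ if $X=\emptyset$ or the subgraph of $G$ formed by the edges in $X$ and their endvertices is connected. A constraint minor of $(G,X)$ is a constraint graph obtained from $(G,X)$ by a finite (possibly empty) sequence of the following operations: deleting an edge not in $X$; contracting an arbitrary edge. When an edge is contracted, its two ends are identified, it disappears itself, and of each class of parallel edges that arises only one edge is kept; this edge belongs to the new constraint if and only if some edge of the class was in the old constraint. Constraint minors are considered up to isomorphism of constraint graphs. **Theorem 2.1.** Let $(G,X)$ be a 3-connected constraint graph. Then $X$ is a connected edge set in $G$ if and only if $(G,X)$ has none of the following six constraint graphs as a constraint minor: 1. the constraint $K_4$: the graph $K_4$, where the constraint consists of two disjoint edges; 2. the constraint wheel: the wheel with four spokes, where the constraint consists of two opposite edges of the rim; 3. the four constraint prisms: the prism (two disjoint triangles joined by a perfect matching of three edges), where the constraint consists of (a) all six edges of the two triangles; (b) all three edges of one triangle and two edges of the other; (c)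 two edges of each triangle, such that the two triangle edges not in the constraint lie in a common 4-cycle of the prism; (d) two edges of each triangle, such that the two triangle edges not in the constraint do not lie in a common 4-cycle of the prism. -/

import Mathlib

/-- A constraint graph `(G, X)`: a simple graph `G` together with a set `X` of edges of `G`. -/
structure ConstraintGraph (V : Type*) where
  /-- the underlying graph `G` -/
  graph : SimpleGraph V
  /-- the edge set `X` -/
  constraint : Set (Sym2 V)
  constraint_subset : constraint ⊆ graph.edgeSet

/-- A graph is `k`-connected if it has more than `k` vertices and it remains connected whenever
fewer than `k` vertices are removed. -/
def SimpleGraph.IsKConnected {V : Type*} (G : SimpleGraph V) (k : ℕ) : Prop :=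
  (k : ℕ∞) < ENat.card V ∧
    ∀ S : Set V, S.encard < (k : ℕ∞) → (G.induce Sᶜ).Connected

namespace ConstraintGraph

/-- The subgraph `G[X]`: its edges are those in `X`, its vertices are the endvertices of these. -/
def spanned {V : Type*} (C : ConstraintGraph V) : C.graph.Subgraph where
  verts := {v | ∃ e ∈ C.constraint, v ∈ e}
  Adj a b := s(a, b) ∈ C.constraint
  adj_sub h := C.constraint_subset h
  edge_vert {a b} h := ⟨s(a, b), h, Sym2.mem_mk_left a b⟩
  symm := ⟨fun a b h => by rwa [Sym2.eq_swap]⟩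

/-- `X` is a connected edge set in `G`. By convention, the empty set is connected. -/
def IsConstraintConnected {V : Type*} (C : ConstraintGraph V) : Prop :=
  C.constraint = ∅ ∨ C.spanned.Connected

/-- Deletion of an edge that is not in the constraint. -/
def deleteEdge {V : Type*} (C : ConstraintGraph V) (e : Sym2 V) (he : e ∉ C.constraint) :
    ConstraintGraph V where
  graph := C.graph.deleteEdges {e}
  constraint := C.constraint
  constraint_subset := fun x hx => by
    rw [SimpleGraph.edgeSet_deleteEdges]
    exact ⟨C.constraint_subset hx, fun h => he (h ▸ hx)⟩

/-- The vertex set after contracting `e`: the two ends of `e` are identified. -/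
abbrev ContractVert {V : Type*} (e : Sym2 V) : Type _ :=
  Quot fun x y : V => s(x, y) = e

/-- Contraction of an edge `e`. The ends of `e` are identified, the loop that arises from `e` is
discarded and of every parallel class only one edge is kept. As edges outside the
constraint are discarded first, the edge that is kept lies in the constraint if and only if
some edge of its parallel class does. -/
def contractEdge {V : Type*} (C : ConstraintGraph V) (e : Sym2 V) :
    ConstraintGraph (ContractVert e) where
  graph := C.graph.map (Quot.mk _)
  constraint := {f | ¬ f.IsDiag ∧ ∃ x ∈ C.constraint, x.map (Quot.mk _) = f}
  constraint_subset := by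
    rintro f ⟨hf, x, hx, rfl⟩
    induction x using Sym2.ind with
    | _ a b => exact ⟨fun h => hf h, a, b, C.constraint_subset hx, rfl, rfl⟩

/-- Isomorphism of constraint graphs. -/
def Isomorphic {V W : Type*} (C : ConstraintGraph V) (D : ConstraintGraph W) : Prop :=
  ∃ φ : C.graph ≃g D.graph, Sym2.map φ '' C.constraint = D.constraint

universe u v

/-- `IsConstraintMinorOf D C`: the constraint graph `C` has a constraint minor isomorphic to `D`,
that is, a constraint graph isomorphic to `D` arises from `C` by a finite sequence of contractions
of arbitrary edges and deletions of edges that are not in the constraint. -/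
inductive IsConstraintMinorOf {W : Type v} (D : ConstraintGraph W) :
    {V : Type u} → ConstraintGraph V → Prop
  | iso {V : Type u} (C : ConstraintGraph V) (h : C.Isomorphic D) : IsConstraintMinorOf D C
  | delete {V : Type u} (C : ConstraintGraph V) (e : Sym2 V) (he : e ∈ C.graph.edgeSet)
      (heX : e ∉ C.constraint) (h : IsConstraintMinorOf D (C.deleteEdge e heX)) :
      IsConstraintMinorOf D C
  | contract {V : Type u} (C : ConstraintGraph V) (e : Sym2 V) (he : e ∈ C.graph.edgeSet)
      (h : IsConstraintMinorOf D (C.contractEdge e)) : IsConstraintMinorOf D C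

/-- The constraint `K₄`: the constraint consists of two disjoint edges. -/
def constraintK4 : ConstraintGraph (Fin 4) where
  graph := ⊤
  constraint := {s(0, 1), s(2, 3)}
  constraint_subset := by
    rintro e (rfl | rfl) <;> simp

/-- The wheel with four spokes: the hub `4` is joined to all vertices of the 4-cycle `0 1 2 3`. -/
def wheelGraph : SimpleGraph (Fin 5) :=
  SimpleGraph.fromEdgeSet
    {s(0, 1), s(1, 2), s(2, 3), s(3, 0), s(4, 0), s(4, 1), s(4, 2), s(4, 3)}

/-- The constraint wheel: the constraint consists of two opposite rim edges. -/
def constraintWheel : ConstraintGraph (Fin 5) where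
  graph := wheelGraph
  constraint := {s(0, 1), s(2, 3)}
  constraint_subset := by
    rintro e (rfl | rfl) <;> simp [wheelGraph]

/-- The prism: the triangles `0 1 2` and `3 4 5`, joined by the edges `03`, `14`, `25`. -/
def prismGraph : SimpleGraph (Fin 6) :=
  SimpleGraph.fromEdgeSet
    {s(0, 1), s(1, 2), s(0, 2), s(3, 4), s(4, 5), s(3, 5), s(0, 3), s(1, 4), s(2, 5)}

/-- The constraint prism whose constraint consists of all edges of both triangles. -/
def constraintPrism₁ : ConstraintGraph (Fin 6) where
  graph := prismGraph
  constraint := {s(0, 1), s(1, 2), s(0, 2), s(3, 4), s(4, 5), s(3, 5)}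
  constraint_subset := by
    rintro e (rfl | rfl | rfl | rfl | rfl | rfl) <;> simp [prismGraph]

/-- The constraint prism whose constraint consists of all edges of one triangle and
two edges of the other. -/
def constraintPrism₂ : ConstraintGraph (Fin 6) where
  graph := prismGraph
  constraint := {s(0, 1), s(1, 2), s(0, 2), s(3, 4), s(4, 5)}
  constraint_subset := by
    rintro e (rfl | rfl | rfl | rfl | rfl) <;> simp [prismGraph]

/-- The constraint prism whose constraint consists of two edges of each triangle, such that the
two edges missing from the triangles lie in a common 4-cycle. -/
def constraintPrism₃ : ConstraintGraph (Fin 6) where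
  graph := prismGraph
  constraint := {s(0, 1), s(1, 2), s(3, 4), s(4, 5)}
  constraint_subset := by
    rintro e (rfl | rfl | rfl | rfl) <;> simp [prismGraph]

/-- The constraint prism whose constraint consists of two edges of each triangle, such that the
two edges missing from the triangles do not lie in a common 4-cycle. -/
def constraintPrism₄ : ConstraintGraph (Fin 6) where
  graph := prismGraph
  constraint := {s(0, 1), s(1, 2), s(3, 4), s(3, 5)}
  constraint_subset := by
    rintro e (rfl | rfl | rfl | rfl) <;> simp [prismGraph]

end ConstraintGraph

/-! A constraint is disconnected exactly when some bipartition of the vertices is crossed by no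
constraint edge and has a constraint edge on either side (`isConstraintConnected_iff`). Such a cut
pulls back along deletions, contractions and isomorphisms, and each of the six obstructions has one;
this is the easy direction.

The converse is an induction on the number of vertices plus edges
(`hasObstruction_of_isConstraintCut`). A deletion or contraction that preserves 3-connectedness and
some cut reduces the problem, so assume that there is none (`IsIrreducible`). The engine is
`TriConn.exists_contract`: if `zv` cannot be deleted and no edge at `z` can be contracted, then `v`
has degree three, `z` has larger degree, and the other two edges at `v` can be contracted. In an
irreducible graph with three constraint components, a contractible edge would have to meet all
three, so there are just two components `K` and `K'`. If a vertex lies outside both, some such `z`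
has a neighbour in one of them; no edge at `z` is contractible, which forces both components to be
single edges and the whole graph to be the wheel.

Otherwise `K` and `K'` partition the vertices. Unless the constraint `K₄` arises, Menger's theorem
for two paths shows that neither side has a cutvertex and that every vertex has at most one
neighbour across. By 3-connectedness there are three disjoint edges across, and
`exists_rooted_triangle` extends their ends on each side to three pairwise adjacent branch sets.
This is a prism without constraint edges in its matching. As the constraint is connected on each
side, it contains at least two edges of each triangle, and up to symmetry these are the four prisms.
-/

namespace SimpleGraph

/-! ### Connected sets and Menger's theorem for two paths -/

variable {V : Type*}

/-- A set of vertices that induces a connected subgraph, described by cuts: the only nonempty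
subset of `A` that no edge inside `A` leaves is `A` itself. -/
def ConnSet (G : SimpleGraph V) (A : Set V) : Prop :=
  A.Nonempty ∧ ∀ B ⊆ A, B.Nonempty → (∀ b ∈ B, ∀ a ∈ A, G.Adj b a → a ∈ B) → A ⊆ B

theorem ConnSet.mono {G H : SimpleGraph V} (h : G ≤ H) {A : Set V} (hA : G.ConnSet A) :
    H.ConnSet A :=
  ⟨hA.1, fun B hB hne hc => hA.2 B hB hne fun b hb a ha hab => hc b hb a ha (h hab)⟩

theorem connSet_singleton (G : SimpleGraph V) (x : V) : G.ConnSet {x} := by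
  refine ⟨⟨x, rfl⟩, fun B hB hne _ => ?_⟩
  obtain ⟨b, hb⟩ := hne
  have := hB hb
  rintro y rfl
  simp_all

theorem ConnSet.union_of_inter {G : SimpleGraph V} {A B : Set V} (hA : G.ConnSet A)
    (hB : G.ConnSet B) (h : (A ∩ B).Nonempty) : G.ConnSet (A ∪ B) := by
  refine ⟨hA.1.mono Set.subset_union_left, fun C hC hne hcl => ?_⟩
  have key : ∀ D, G.ConnSet D → D ⊆ A ∪ B → (C ∩ D).Nonempty → D ⊆ C := by
    intro D hD hDs hne x hx
    exact (hD.2 (C ∩ D) Set.inter_subset_right hne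
      (fun b hb a ha hab => ⟨hcl b hb.1 a (hDs ha) hab, ha⟩) hx).1
  obtain ⟨x, hxA, hxB⟩ := h
  obtain ⟨c, hc⟩ := hne
  have hA' := key A hA Set.subset_union_left
  have hB' := key B hB Set.subset_union_right
  rcases hC hc with h1 | h1
  · have := hA' ⟨c, hc, h1⟩
    exact Set.union_subset this (hB' ⟨x, this hxA, hxB⟩)
  · have := hB' ⟨c, hc, h1⟩
    exact Set.union_subset (hA' ⟨x, this hxB, hxA⟩) this

theorem connSet_pair {G : SimpleGraph V} {a b : V} (h : G.Adj a b) : G.ConnSet {a, b} := by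
  refine ⟨⟨a, by simp⟩, fun B hB hne hcl => ?_⟩
  obtain ⟨c, hc⟩ := hne
  have hc' := hB hc
  simp only [Set.mem_insert_iff, Set.mem_singleton_iff] at hc'
  have := h.symm
  rcases hc' with rfl | rfl
  · have := hcl _ hc b (by simp) h
    rintro x (rfl | rfl) <;> assumption
  · have := hcl _ hc a (by simp) h.symm
    rintro x (rfl | rfl) <;> assumption

theorem ConnSet.insert_of_adj {G : SimpleGraph V} {A : Set V} (hA : G.ConnSet A) {a b : V}
    (ha : a ∈ A) (hab : G.Adj a b) : G.ConnSet (insert b A) := by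
  have := hA.union_of_inter (connSet_pair hab) ⟨a, ha, by simp⟩
  convert this using 1
  ext x
  simp only [Set.mem_insert_iff, Set.mem_union, Set.mem_singleton_iff]
  grind

/-- Both sides of a bipartition of a connected set are joined by an edge. -/
theorem ConnSet.exists_adj {G : SimpleGraph V} {W B : Set V} (hW : G.ConnSet W) (hB : B ⊆ W)
    (hne : B.Nonempty) {x : V} (hx : x ∈ W) (hxB : x ∉ B) :
    ∃ b ∈ B, ∃ a ∈ W, a ∉ B ∧ G.Adj b a := by
  by_contra! h
  refine hxB (hW.2 B hB hne (fun b hb a ha hab => ?_) hx)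
  by_contra ha'
  exact h b hb a ha ha' hab

/-- The component of `x` in the subgraph induced on `W`. -/
theorem exists_component (G : SimpleGraph V) {W : Set V} {x : V} (hx : x ∈ W) :
    ∃ K ⊆ W, x ∈ K ∧ G.ConnSet K ∧ ∀ b ∈ K, ∀ a ∈ W, G.Adj b a → a ∈ K := by
  let cl : Set (Set V) := {B | B ⊆ W ∧ x ∈ B ∧ ∀ b ∈ B, ∀ a ∈ W, G.Adj b a → a ∈ B}
  have hKcl : ∀ b ∈ ⋂₀ cl, ∀ a ∈ W, G.Adj b a → a ∈ ⋂₀ cl :=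
    fun b hb a ha hab B hB => hB.2.2 b (hb B hB) a ha hab
  have hKW : ⋂₀ cl ⊆ W := fun y hy => hy W ⟨subset_rfl, hx, fun _ _ a ha _ => ha⟩
  refine ⟨⋂₀ cl, hKW, fun B hB => hB.2.1, ⟨⟨x, fun B hB => hB.2.1⟩, ?_⟩, hKcl⟩
  intro B hBK ⟨b, hb⟩ hBcl
  by_cases hxB : x ∈ B
  · intro y hy
    exact hy B ⟨hBK.trans hKW, hxB, fun b hb a ha hab => hBcl b hb a (hKcl b (hBK hb) a ha hab) hab⟩
  · exfalso
    -- If `B` misses `x`, its complement in the intersection is again closed and contains `x`, so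
    -- minimality applies to it.
    have : b ∈ (⋂₀ cl) \ B := by
      refine hBK hb _ ⟨Set.sdiff_subset.trans hKW, ⟨fun C hC => hC.2.1, hxB⟩, ?_⟩
      intro c hc a ha hca
      exact ⟨hKcl c hc.1 a ha hca, fun haB => hc.2 (hBcl a haB c hc.1 hca.symm)⟩
    exact this.2 hb

/-- Disjoint connected subsets of a connected set extend to a bipartition into connected sets. -/
theorem ConnSet.exists_bipartition [Finite V] {G : SimpleGraph V} {W : Set V} (hW : G.ConnSet W)
    {C D : Set V} (hC : G.ConnSet C) (hD : G.ConnSet D) (hCW : C ⊆ W) (hDW : D ⊆ W)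
    (hCD : Disjoint C D) :
    ∃ C' D', C ⊆ C' ∧ D ⊆ D' ∧ G.ConnSet C' ∧ G.ConnSet D' ∧ Disjoint C' D' ∧ C' ∪ D' = W := by
  induction hn : (W \ (C ∪ D)).ncard using Nat.strong_induction_on generalizing C D with
  | _ n ih =>
    subst hn
    by_cases hx : ∃ x ∈ W, x ∉ C ∪ D
    · obtain ⟨x, hxW, hx⟩ := hx
      obtain ⟨b, hb, a, ha, hab, hadj⟩ := hW.exists_adj (Set.union_subset hCW hDW)
        (hC.1.mono Set.subset_union_left) hxW hx
      have hlt : ∀ E, insert a (C ∪ D) ⊆ E → (W \ E).ncard < (W \ (C ∪ D)).ncard := by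
        intro E hE
        refine Set.ncard_lt_ncard ⟨fun y hy => ⟨hy.1, fun h => hy.2 (hE (Or.inr h))⟩, fun h => ?_⟩
          (Set.toFinite _)
        exact (h ⟨ha, hab⟩).2 (hE (Or.inl rfl))
      simp only [Set.mem_union, not_or] at hab
      rcases hb with hb | hb
      · obtain ⟨C', D', h1, h2, h3⟩ := ih _ (hlt (insert a C ∪ D) (by grind))
          (hC.insert_of_adj hb hadj) hD (by grind) hDW
          (by rw [Set.disjoint_insert_left]; exact ⟨hab.2, hCD⟩) rfl
        exact ⟨C', D', (Set.subset_insert _ _).trans h1, h2, h3⟩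
      · obtain ⟨C', D', h1, h2, h3⟩ := ih _ (hlt (C ∪ insert a D) (by grind))
          hC (hD.insert_of_adj hb hadj) hCW (by grind)
          (by rw [Set.disjoint_insert_right]; exact ⟨hab.1, hCD⟩) rfl
        exact ⟨C', D', h1, (Set.subset_insert _ _).trans h2, h3⟩
    · push Not at hx
      exact ⟨C, D, subset_rfl, subset_rfl, hC, hD, hCD, (Set.union_subset hCW hDW).antisymm hx⟩

/-- Inside `W`, the vertex `s` separates `P` from `Q`. -/
def SeparatedBy (G : SimpleGraph V) (W P Q : Set V) (s : V) : Prop :=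
  ∃ A ⊆ W, s ∉ A ∧ (∀ a ∈ A, ∀ b ∈ W, G.Adj a b → b ∈ A ∨ b = s) ∧
    (∀ p ∈ P, p ∈ A ∨ p = s) ∧ ∀ q ∈ Q, q ∉ A

/-- Inside `W` there are two disjoint connected sets that both meet `P` and `Q`. -/
def Linked (G : SimpleGraph V) (W P Q : Set V) : Prop :=
  ∃ C D, C ⊆ W ∧ D ⊆ W ∧ Disjoint C D ∧ G.ConnSet C ∧ G.ConnSet D ∧
    (C ∩ P).Nonempty ∧ (C ∩ Q).Nonempty ∧ (D ∩ P).Nonempty ∧ (D ∩ Q).Nonempty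

theorem Linked.mono {G : SimpleGraph V} {W P Q W' P' Q' : Set V} (h : G.Linked W P Q)
    (hW : W ⊆ W') (hP : P ⊆ P') (hQ : Q ⊆ Q') : G.Linked W' P' Q' := by
  obtain ⟨C, D, h1, h2, h3, h4, h5, h6, h7, h8, h9⟩ := h
  exact ⟨C, D, h1.trans hW, h2.trans hW, h3, h4, h5, h6.mono (by grind), h7.mono (by grind),
    h8.mono (by grind), h9.mono (by grind)⟩

/-- The trivial path `{x}` is one of the two sets. If no connected set avoiding `x` meets both `P`
and `Q`, then the vertices reachable from `P` in `W \ {x}` show that `x` separates. -/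
theorem linked_of_mem_inter {G : SimpleGraph V} {W P Q : Set V} (hP : P ⊆ W) (hQ : Q ⊆ W)
    {x : V} (hxP : x ∈ P) (hxQ : x ∈ Q) (h : ¬ G.SeparatedBy W P Q x) : G.Linked W P Q := by
  by_contra hL
  refine h ⟨{a | ∃ K ⊆ W \ {x}, G.ConnSet K ∧ a ∈ K ∧ (K ∩ P).Nonempty}, ?_, ?_, ?_, ?_, ?_⟩
  · rintro a ⟨K, hK, -, ha, -⟩
    exact (hK ha).1
  · rintro ⟨K, hK, -, ha, -⟩
    exact (hK ha).2 rfl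
  · rintro a ⟨K, hK, hKc, ha, hKP⟩ b hb hab
    by_cases hbx : b = x
    · exact Or.inr hbx
    · exact Or.inl ⟨insert b K, by grind, hKc.insert_of_adj ha hab, Set.mem_insert _ _,
        hKP.mono (by grind)⟩
  · intro p hp
    by_cases hbx : p = x
    · exact Or.inr hbx
    · exact Or.inl ⟨{p}, by grind, G.connSet_singleton p, rfl, ⟨p, rfl, hp⟩⟩
  · rintro q hq ⟨K, hK, hKc, hqK, hKP⟩
    exact hL ⟨{x}, K, by grind, by grind, by grind, G.connSet_singleton x, hKc, ⟨x, rfl, hxP⟩,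
      ⟨x, rfl, hxQ⟩, hKP, ⟨q, hqK, hq⟩⟩

theorem linked_of_two_adj {G : SimpleGraph V} {W P Q : Set V} (hP : P ⊆ W) (hQ : Q ⊆ W)
    (hPQ : Disjoint P Q) {p p' q q' : V} (hp : p ∈ P) (hp' : p' ∈ P) (hq : q ∈ Q) (hq' : q' ∈ Q)
    (hpp : p ≠ p') (hqq : q ≠ q') (h : G.Adj p q) (h' : G.Adj p' q') : G.Linked W P Q := by
  have := Set.disjoint_left.1 hPQ
  refine ⟨{p, q}, {p', q'}, by grind, by grind, ?_, connSet_pair h, connSet_pair h',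
    ⟨p, by simp, hp⟩, ⟨q, by simp, hq⟩, ⟨p', by simp, hp'⟩, ⟨q', by simp, hq'⟩⟩
  rw [Set.disjoint_left]
  simp only [Set.mem_insert_iff, Set.mem_singleton_iff]
  rintro x (rfl | rfl) (rfl | rfl) <;> first | exact hpp rfl | exact hqq rfl | skip
  · exact this hp hq'
  · exact this hp' hq

/-- Gluing two linkages along a separator with two vertices. -/
theorem Linked.glue {G : SimpleGraph V} {W W₁ W₂ P Q : Set V} {v s : V} (hvs : v ≠ s)
    (h1 : G.Linked W₁ P {v, s}) (h2 : G.Linked W₂ {v, s} Q) (hW₁ : W₁ ⊆ W) (hW₂ : W₂ ⊆ W)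
    (hW : W₁ ∩ W₂ ⊆ {v, s}) : G.Linked W P Q := by
  -- Two disjoint sets that both meet `{v, s}` do so in different vertices; naming them by these
  -- makes the two linkages match up.
  have key : ∀ W P, G.Linked W P {v, s} → ∃ C D, C ⊆ W ∧ D ⊆ W ∧ Disjoint C D ∧ G.ConnSet C ∧
      G.ConnSet D ∧ (C ∩ P).Nonempty ∧ (D ∩ P).Nonempty ∧ v ∈ C ∧ s ∈ D := by
    clear h1 h2
    rintro W P ⟨C, D, h1, h2, h3, h4, h5, h6, ⟨x, hx, hx'⟩, h8, ⟨y, hy, hy'⟩⟩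
    have := Set.disjoint_left.1 h3
    simp only [Set.mem_insert_iff, Set.mem_singleton_iff] at hx' hy'
    rcases hx' with rfl | rfl <;> rcases hy' with rfl | rfl
    · exact (this hx hy).elim
    · exact ⟨C, D, h1, h2, h3, h4, h5, h6, h8, hx, hy⟩
    · exact ⟨D, C, h2, h1, h3.symm, h5, h4, h8, h6, hy, hx⟩
    · exact (this hx hy).elim
  have h2' : G.Linked W₂ Q {v, s} := by
    obtain ⟨C, D, h1, h2, h3, h4, h5, h6, h7, h8, h9⟩ := h2
    exact ⟨C, D, h1, h2, h3, h4, h5, h7, h6, h9, h8⟩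
  obtain ⟨C, D, hC, hD, hCD, hCc, hDc, hCP, hDP, hv, hs⟩ := key _ _ h1
  obtain ⟨C', D', hC', hD', hCD', hCc', hDc', hCQ, hDQ, hv', hs'⟩ := key _ _ h2'
  refine ⟨C ∪ C', D ∪ D', by grind, by grind, ?_, hCc.union_of_inter hCc' ⟨v, hv, hv'⟩,
    hDc.union_of_inter hDc' ⟨s, hs, hs'⟩, hCP.mono (by grind), hCQ.mono (by grind),
    hDP.mono (by grind), hDQ.mono (by grind)⟩
  rw [Set.disjoint_left] at hCD hCD' ⊢
  intro x hx hy
  have := @hW x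
  simp only [Set.mem_inter_iff, Set.mem_insert_iff, Set.mem_singleton_iff] at this
  grind

/-- Menger's theorem for two paths, within a set `W` of vertices. -/
theorem linked_of_not_separatedBy [Finite V] {G : SimpleGraph V} {W P Q : Set V} (hP : P ⊆ W)
    (hQ : Q ⊆ W) (hne : P.Nonempty) (h : ∀ s, ¬ G.SeparatedBy W P Q s) : G.Linked W P Q := by
  induction hn : W.ncard using Nat.strong_induction_on generalizing W P Q with
  | _ n ih =>
    subst hn
    by_cases hPQ : Disjoint P Q
    swap
    · obtain ⟨x, hxP, hxQ⟩ := Set.not_disjoint_iff.1 hPQ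
      exact linked_of_mem_inter hP hQ hxP hxQ (h x)
    by_contra hL
    have hPs : ∀ s, ∃ p ∈ P, p ≠ s := by
      intro s
      by_contra! hc
      exact h s ⟨∅, by simp, by simp, by simp, fun p hp => Or.inr (hc p hp), by simp⟩
    have hQs : ∀ s, ∃ q ∈ Q, q ≠ s := by
      intro s
      by_contra! hc
      refine h s ⟨W \ {s}, by grind, by grind, by grind, by grind, by grind⟩
    -- A linkage avoiding `v` would do, so by induction some `s` separates in `W \ {v}`, and `{v,
    -- s}` separates in `W`. If both sides had further vertices, linkages on the two sides could be
    -- glued along `{v, s}`. Hence `P` or `Q` lies in `{v, s}`, and it contains `v` as `s` alone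
    -- does not separate.
    have step : ∀ v ∈ W, ∃ s, (v ∈ P ∧ P ⊆ {v, s}) ∨ (v ∈ Q ∧ Q ⊆ {v, s}) := by
      intro v hv
      have hsep : ∃ s, G.SeparatedBy (W \ {v}) (P \ {v}) (Q \ {v}) s := by
        by_contra! hc
        refine hL (Linked.mono (ih (W \ {v}).ncard ?_ (by grind) (by grind) ?_ hc rfl)
          Set.sdiff_subset Set.sdiff_subset Set.sdiff_subset)
        · exact Set.ncard_sdiff_singleton_lt_of_mem hv
        · obtain ⟨p, hp, hpv⟩ := hPs v
          exact ⟨p, hp, hpv⟩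
      obtain ⟨s, A, hAW, hsA, hAcl, hAP, hAQ⟩ := hsep
      have hsv : s ∈ W ∧ s ≠ v := by
        by_contra hs
        refine h v ⟨A, by grind, by grind, ?_, ?_, by grind⟩
        · intro a ha b hb hab
          have := hAcl a ha b
          grind
        · intro p hp
          have := hAP p
          have := hP hp
          grind
      have hAcl' : ∀ a ∈ A, ∀ b ∈ W, G.Adj a b → b ∈ A ∨ b = v ∨ b = s := by
        intro a ha b hb hab
        have := hAcl a ha b
        grind
      have hAP' : ∀ p ∈ P, p ∈ A ∨ p = v ∨ p = s := by
        intro p hp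
        have := hAP p
        grind
      have hAQ' : ∀ q ∈ Q, q ∉ A := by grind
      refine ⟨s, ?_⟩
      by_cases hA : A.Nonempty
      swap
      · rw [Set.not_nonempty_iff_eq_empty] at hA
        subst hA
        obtain ⟨p, hp, hps⟩ := hPs s
        left
        grind
      by_cases hB : ∃ x ∈ W, x ∉ A ∧ x ≠ v ∧ x ≠ s
      swap
      · push Not at hB
        obtain ⟨q, hq, hqs⟩ := hQs s
        right
        grind
      exfalso
      obtain ⟨x, hxW, hxA, hxv, hxs⟩ := hB
      obtain ⟨y, hy⟩ := hA
      refine hL (Linked.glue (W₁ := A ∪ {v, s}) (W₂ := W \ A) hsv.2.symm (ih _ ?_ ?_ ?_ hne ?_ rfl)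
        (ih _ ?_ ?_ ?_ ?_ ?_ rfl) ?_ ?_ ?_)
      · exact Set.ncard_lt_ncard ⟨by grind, fun hh => by have := hh hxW; grind⟩ (Set.toFinite _)
      · grind
      · grind
      · rintro r ⟨A', hA'1, hA'2, hA'3, hA'4, hA'5⟩
        refine h r ⟨A', by grind, hA'2, ?_, hA'4, by grind⟩
        intro a ha b hb hab
        have h1 := hA'5 v
        have h2 := hA'5 s
        have h3 := hA'1 ha
        have h4 : a ∈ A := by grind
        have := hAcl' a h4 b hb hab
        exact hA'3 a ha b (by grind) hab
      · exact Set.ncard_lt_ncard ⟨by grind, fun hh => by have := hh (hAW hy).1; grind⟩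
          (Set.toFinite _)
      · grind
      · grind
      · exact ⟨v, by simp⟩
      · rintro r ⟨A', hA'1, hA'2, hA'3, hA'4, hA'5⟩
        have h1 := hA'4 v
        have h2 := hA'4 s
        refine h r ⟨(A' ∪ A) \ {r}, by grind, by grind, ?_, by grind, by grind⟩
        rintro a ⟨ha | ha, har⟩ b hb hab
        · have := hA'3 a ha b
          grind
        · have := hAcl' a ha b hb hab
          grind
      · grind
      · grind
      · grind
    have hdj := Set.disjoint_left.1 hPQ
    obtain ⟨p, hp⟩ := hne
    obtain ⟨p', hp', hpp⟩ := hPs p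
    obtain ⟨q, hq, hqp⟩ := hQs p
    obtain ⟨q', hq', hqq⟩ := hQs q
    have hPeq : ∀ x ∈ P, x = p ∨ x = p' := by
      obtain ⟨s, hs⟩ := step p (hP hp)
      grind
    have hQeq : ∀ x ∈ Q, x = q ∨ x = q' := by
      obtain ⟨s, hs⟩ := step q (hQ hq)
      grind
    -- Only the case that `W` consists of two vertices of `P` and two of `Q` is left. Each vertex of
    -- `P` has a neighbour in `Q`, and without two disjoint edges all of them end in one vertex,
    -- which separates.
    have hWeq : ∀ x ∈ W, x = p ∨ x = p' ∨ x = q ∨ x = q' := by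
      intro x hx
      obtain ⟨s, hs⟩ := step x hx
      grind
    have hadj : ∀ a b, a ∈ P → b ∈ P → a ≠ b → ∃ c ∈ Q, G.Adj a c := by
      intro a b ha hb hab
      by_contra! hc
      refine h b ⟨{a}, by grind, by grind, ?_, by grind, by grind⟩
      rintro x rfl c hcW hxc
      have := hc c
      have := hxc.ne
      grind
    obtain ⟨c, hcQ, hpc⟩ := hadj p p' hp hp' hpp.symm
    obtain ⟨c', hcQ', hpc'⟩ := hadj p' p hp' hp hpp
    have nomatch2 : ∀ a b, a ∈ Q → b ∈ Q → a ≠ b → G.Adj p a → G.Adj p' b → False :=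
      fun a b ha hb hab h1 h2 => hL (linked_of_two_adj hP hQ hPQ hp hp' ha hb hpp.symm hab h1 h2)
    refine h c ⟨{p, p'}, by grind, by grind, ?_, by grind, by grind⟩
    intro x hx b hb hxb
    by_contra! hcon
    have hbQ : b ∈ Q := by
      have := hWeq b hb
      grind
    have hcc : c = c' := by
      by_contra hne
      exact nomatch2 c c' hcQ hcQ' hne hpc hpc'
    subst hcc
    rcases hx with rfl | rfl
    · exact nomatch2 b c hbQ hcQ hcon.2 hxb hpc'
    · exact nomatch2 c b hcQ hbQ hcon.2.symm hpc hxb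

end SimpleGraph

/-! ### 3-connected graphs: uncrossing separators, contractible and deletable edges -/

namespace SimpleGraph

variable {V : Type*}

/-- 3-connectedness, described by cuts: no three vertices exhaust the graph, and a nonempty set of
vertices with at most two outer neighbours misses no vertex other than these. -/
def TriConn (G : SimpleGraph V) : Prop :=
  (∀ r s t : V, ∃ v, v ≠ r ∧ v ≠ s ∧ v ≠ t) ∧
    ∀ (A : Set V) (s t : V), A.Nonempty →
      (∀ a ∈ A, ∀ b, G.Adj a b → b ∈ A ∨ b = s ∨ b = t) → ∀ v, v ∈ A ∨ v = s ∨ v = t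

theorem Connected.eq_univ_of_closed {G : SimpleGraph V} (hG : G.Connected) {A : Set V}
    (hA : A.Nonempty) (h : ∀ a ∈ A, ∀ b, G.Adj a b → b ∈ A) (v : V) : v ∈ A := by
  obtain ⟨x, hx⟩ := hA
  obtain ⟨p⟩ := hG.preconnected x v
  induction p with
  | nil => exact hx
  | cons hadj _ ih => exact ih (h _ hx _ hadj)

theorem IsKConnected.triConn [Finite V] {G : SimpleGraph V} (hG : G.IsKConnected 3) :
    G.TriConn := by
  classical
  have := Fintype.ofFinite V
  refine ⟨fun r s t => ?_, fun A s t ⟨x, hx⟩ hcl v => ?_⟩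
  · have h1 := hG.1
    rw [ENat.card_eq_coe_fintype_card] at h1
    have h1 : 3 < Fintype.card V := by exact_mod_cast h1
    have h2 : ({r, s, t} : Finset V).card < (Finset.univ : Finset V).card :=
      lt_of_le_of_lt Finset.card_le_three h1
    obtain ⟨v, -, hv⟩ := Finset.exists_mem_notMem_of_card_lt_card h2
    exact ⟨v, by simpa using hv⟩
  · by_contra! hv
    -- `TriConn` allows `s` and `t` to lie in `A`; only those outside are removed.
    have hS : (({s, t} : Set V) \ A).encard < ((3 : ℕ) : ℕ∞) := by
      refine lt_of_le_of_lt (Set.encard_le_encard Set.sdiff_subset) ?_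
      refine lt_of_le_of_lt (Set.encard_insert_le _ _) ?_
      rw [Set.encard_singleton]
      norm_num
    have := (hG.2 _ hS).eq_univ_of_closed (A := {y | y.1 ∈ A}) ⟨⟨x, by grind⟩, hx⟩
      (fun a ha b hab => by
        have h1 := hcl a ha b hab
        have h2 := b.2
        simp only [Set.mem_compl_iff, Set.mem_sdiff, Set.mem_insert_iff,
          Set.mem_singleton_iff, not_and, not_not] at h2
        rcases h1 with h1 | h1 | h1
        · exact h1
        · exact h2 (Or.inl h1)
        · exact h2 (Or.inr h1)) ⟨v, by grind⟩
    exact hv.1 this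

/-- In a cut description of 3-connectedness the cut vertices may be taken outside the set. -/
theorem triConn_of_forall_notMem {G : SimpleGraph V}
    (h1 : ∀ r s t : V, ∃ v, v ≠ r ∧ v ≠ s ∧ v ≠ t)
    (h2 : ∀ (A : Set V) (s t : V), A.Nonempty → s ∉ A → t ∉ A →
      (∀ a ∈ A, ∀ b, G.Adj a b → b ∈ A ∨ b = s ∨ b = t) → ∀ v, v ∈ A ∨ v = s ∨ v = t) :
    G.TriConn := by
  refine ⟨h1, fun A s t hne hcl v => ?_⟩
  by_cases hs : s ∈ A <;> by_cases ht : t ∈ A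
  -- Here no edge leaves `A`. Taking `v` as the cut vertex gives that `A` misses `v` only, so `v` is
  -- isolated, and then the set `{v}` violates the condition.
  · by_contra! hv
    have hcl' : ∀ a ∈ A, ∀ b, G.Adj a b → b ∈ A := by grind
    obtain ⟨x, hx⟩ := hne
    obtain ⟨y, hy1, hy2, -⟩ := h1 v x x
    have h3 := h2 A v v ⟨x, hx⟩ hv.1 hv.1 (fun a ha b hab => Or.inl (hcl' a ha b hab))
    have h4 := h2 {v} x x ⟨v, rfl⟩ (by grind) (by grind) (fun a ha b hab => by
      have := hcl' b
      have := h3 b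
      have := hab.symm
      grind) y
    grind
  · have := h2 A t t hne ht ht (by grind) v
    grind
  · have := h2 A s s hne hs hs (by grind) v
    grind
  · exact h2 A s t hne hs ht hcl v

theorem TriConn.false_of_cut {G : SimpleGraph V} (hG : G.TriConn) {A : Set V} (s t : V) {x v : V}
    (hx : x ∈ A) (hv : v ∉ A) (hs : v ≠ s) (ht : v ≠ t)
    (hcl : ∀ a ∈ A, ∀ b, G.Adj a b → b ∈ A ∨ b = s ∨ b = t) : False := by
  have := hG.2 A s t ⟨x, hx⟩ hcl v
  tauto

theorem TriConn.exists_adj_ne {G : SimpleGraph V} (hG : G.TriConn) (x s t : V) :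
    ∃ y, G.Adj x y ∧ y ≠ s ∧ y ≠ t := by
  by_contra! h
  obtain ⟨v, h1, h2, h3⟩ := hG.1 x s t
  refine hG.false_of_cut (A := {x}) s t rfl h1 h2 h3 ?_
  rintro a rfl b hab
  have := h b hab
  tauto

theorem TriConn.connSet_univ {G : SimpleGraph V} (hG : G.TriConn) (x : V) :
    G.ConnSet Set.univ := by
  refine ⟨⟨x, trivial⟩, fun B _ ⟨b, hb⟩ hcl v _ => ?_⟩
  have := hG.2 B b b ⟨b, hb⟩ (fun b hb a hab => Or.inl (hcl b hb a trivial hab)) v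
  grind

/-- The vertices outside `{u, v, w}` fall into two nonempty parts without edges between them. -/
structure IsSplit (G : SimpleGraph V) (u v w : V) (F₁ F₂ : Set V) : Prop where
  nonempty_left : F₁.Nonempty
  nonempty_right : F₂.Nonempty
  disjoint : ∀ x ∈ F₁, x ∉ F₂
  notMem_left : u ∉ F₁ ∧ v ∉ F₁ ∧ w ∉ F₁
  notMem_right : u ∉ F₂ ∧ v ∉ F₂ ∧ w ∉ F₂
  ne : u ≠ v ∧ u ≠ w ∧ v ≠ w
  cover : ∀ x, x ∈ F₁ ∨ x ∈ F₂ ∨ x = u ∨ x = v ∨ x = w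
  not_adj : ∀ x ∈ F₁, ∀ y ∈ F₂, ¬ G.Adj x y

theorem IsSplit.swap {G : SimpleGraph V} {u v w : V} {F₁ F₂ : Set V} (h : G.IsSplit u v w F₁ F₂) :
    G.IsSplit u v w F₂ F₁ :=
  ⟨h.2, h.1, fun x h2 h1 => h.3 x h1 h2, h.5, h.4, h.6, fun x => by have := h.7 x; tauto,
    fun x hx y hy hxy => h.8 y hy x hx hxy.symm⟩

theorem IsSplit.symm {G : SimpleGraph V} {u v w : V} {F₁ F₂ : Set V} (h : G.IsSplit u v w F₁ F₂) :
    G.IsSplit v u w F₁ F₂ :=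
  ⟨h.1, h.2, h.3, by have := h.4; tauto, by have := h.5; tauto, ⟨h.6.1.symm, h.6.2.2, h.6.2.1⟩,
    fun x => by have := h.7 x; tauto, h.8⟩

theorem IsSplit.cover_left {G : SimpleGraph V} {u v w : V} {F₁ F₂ : Set V}
    (h : G.IsSplit u v w F₁ F₂) {a b : V} (ha : a ∈ F₁) (hab : G.Adj a b) :
    b ∈ F₁ ∨ b = u ∨ b = v ∨ b = w := by
  have h1 := h.cover b
  have h2 := h.not_adj a ha b
  tauto

/-- Uncrossing of the separators `{z, v, w}` and `{v, p, t}`. The corner `F₂ ∩ D₂` contains `q` and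
so has no boundary of two vertices; this forces `t ∈ F₂` and `w ∉ D₁`. The corners `F₁ ∩ D₁` and `F₂
∩ D₁` are then bounded by `z, v, p` and `z, v, t`, but `v` has no neighbour in them. So both are
empty, and `D₁` is just `{z}`. -/
theorem IsSplit.third_adj_left {G : SimpleGraph V} (hG : G.TriConn) {z v w p q t : V}
    {F₁ F₂ D₁ D₂ : Set V} (hF : G.IsSplit z v w F₁ F₂) (hp : p ∈ F₁) (hq : q ∈ F₂)
    (hN : ∀ x, G.Adj v x → x = z ∨ x = p ∨ x = q) (hD : G.IsSplit v p t D₁ D₂)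
    (hz : z ∈ D₁) (hqD : q ∈ D₂) : t ∈ F₂ ∧ ∀ x, G.Adj z x → x = v ∨ x = p ∨ x = t := by
  have hF1 : ∀ a b, a ∈ F₁ → G.Adj a b → _ := fun a b h1 h2 => hF.cover_left h1 h2
  have hF2 : ∀ a b, a ∈ F₂ → G.Adj a b → _ := fun a b h1 h2 => hF.swap.cover_left h1 h2
  have hD1 : ∀ a b, a ∈ D₁ → G.Adj a b → _ := fun a b h1 h2 => hD.cover_left h1 h2
  have hD2 : ∀ a b, a ∈ D₂ → G.Adj a b → _ := fun a b h1 h2 => hD.swap.cover_left h1 h2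
  obtain ⟨-, -, hFd, hFl, hFr, hFn, hFc, -⟩ := hF
  obtain ⟨-, -, hDd, hDl, hDr, hDn, hDc, -⟩ := hD
  have hzD2 := hDd z hz
  have hpF2 := hFd p hp
  have htF : t ∈ F₂ := by
    by_contra ht
    refine hG.false_of_cut (A := F₂ ∩ D₂) v w (x := q) (v := z) ⟨hq, hqD⟩ (fun h => hzD2 h.2)
      hFn.1 hFn.2.1 ?_
    rintro a ⟨ha1, ha2⟩ b hab
    have h1 := hF2 a b ha1 hab
    have h2 := hD2 a b ha2 hab
    simp only [Set.mem_inter_iff]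
    grind
  have htF1 : t ∉ F₁ := fun h => hFd t h htF
  have hwD : w ∉ D₁ := by
    intro hw
    have hw2 := hDd w hw
    refine hG.false_of_cut (A := F₂ ∩ D₂) v t (x := q) (v := z) ⟨hq, hqD⟩ (fun h => hzD2 h.2)
      hFn.1 (by grind) ?_
    rintro a ⟨ha1, ha2⟩ b hab
    have h1 := hF2 a b ha1 hab
    have h2 := hD2 a b ha2 hab
    simp only [Set.mem_inter_iff]
    grind
  have hqD1 : q ∉ D₁ := fun h => hDd q h hqD
  have e1 : ∀ x ∈ F₁, x ∉ D₁ := by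
    intro x hx hxD
    refine hG.false_of_cut (A := F₁ ∩ D₁) z p (x := x) (v := v) ⟨hx, hxD⟩ (fun h => hFl.2.1 h.1)
      hFn.1.symm hDn.1 ?_
    rintro a ⟨ha1, ha2⟩ b hab
    have h1 := hF1 a b ha1 hab
    have h2 := hD1 a b ha2 hab
    have h3 := hN a
    have h4 := hab.symm
    simp only [Set.mem_inter_iff]
    grind
  have e2 : ∀ x ∈ F₂, x ∉ D₁ := by
    intro x hx hxD
    refine hG.false_of_cut (A := F₂ ∩ D₁) z t (x := x) (v := v) ⟨hx, hxD⟩ (fun h => hFr.2.1 h.1)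
      hFn.1.symm hDn.2.1 ?_
    rintro a ⟨ha1, ha2⟩ b hab
    have h1 := hF2 a b ha1 hab
    have h2 := hD1 a b ha2 hab
    have h3 := hN a
    have h4 := hab.symm
    simp only [Set.mem_inter_iff]
    grind
  refine ⟨htF, fun x hx => ?_⟩
  have h1 := hD1 z x hz hx
  have h2 := hFc x
  have h3 := hx.ne
  grind

/-- If `v` has exactly the neighbours `z, p, q`, where `p` and `q` are separated by
`{z, v, w}`, and contracting `vp` spoils 3-connectedness, then `z` has degree three, too. -/
theorem IsSplit.third_adj {G : SimpleGraph V} (hG : G.TriConn) {z v w p q t : V}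
    {F₁ F₂ D₁ D₂ : Set V} (hF : G.IsSplit z v w F₁ F₂) (hp : p ∈ F₁) (hq : q ∈ F₂)
    (hN : ∀ x, G.Adj v x → x = z ∨ x = p ∨ x = q) (hD : G.IsSplit v p t D₁ D₂) :
    t ∈ F₂ ∧ ∀ x, G.Adj z x → x = v ∨ x = p ∨ x = t := by
  -- `v` has a neighbour on either side, as otherwise `{p, t}` would cut one off. Since `p` is in
  -- the separator, `z` and `q` lie on different sides.
  have key : ∀ E₁ E₂, G.IsSplit v p t E₁ E₂ → z ∈ E₁ ∨ q ∈ E₁ := by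
    intro E₁ E₂ hE
    by_contra! hcon
    obtain ⟨x, hx⟩ := hE.nonempty_left
    refine hG.false_of_cut (A := E₁) p t (x := x) (v := v) hx hE.notMem_left.1 hE.ne.1 hE.ne.2.1 ?_
    intro a ha b hab
    have h1 := hE.cover_left ha hab
    have h2 := hN a
    have h3 := hab.symm
    have h4 := hE.notMem_left
    grind
  have h1 := hD.disjoint z
  have h2 := hD.disjoint q
  rcases key _ _ hD with h | h <;> rcases key _ _ hD.swap with h' | h'
  · exact (h1 h h').elim
  · exact hF.third_adj_left hG hp hq hN hD h h'
  · exact hF.third_adj_left hG hp hq hN hD.swap h' h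
  · exact (h2 h h').elim

/-- A separation by two vertices after the deletion is none of `G`, so the edge `zv` crosses it. If
its end in the separated set is `v`, pass to the opposite side. -/
theorem exists_cut_of_not_triConn_deleteEdges {G : SimpleGraph V} (hG : G.TriConn) {z v : V}
    (h : ¬ (G.deleteEdges {s(z, v)}).TriConn) :
    ∃ (A : Set V) (p q : V), z ∈ A ∧ p ∉ A ∧ q ∉ A ∧ v ∉ A ∧ v ≠ p ∧ v ≠ q ∧
      ∀ a ∈ A, ∀ b, G.Adj a b → b ∈ A ∨ b = p ∨ b = q ∨ (a = z ∧ b = v) := by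
  contrapose! h
  refine triConn_of_forall_notMem hG.1 fun A s t hne hs ht hcl => ?_
  have hcl' : ∀ a ∈ A, ∀ b, G.Adj a b → b ∈ A ∨ b = s ∨ b = t ∨ (a = z ∧ b = v) ∨
      (a = v ∧ b = z) := by
    intro a ha b hab
    by_cases he : s(a, b) = s(z, v)
    · have := Sym2.eq_iff.1 he
      tauto
    · have := hcl a ha b (by rw [deleteEdges_adj]; exact ⟨hab, he⟩)
      tauto
  refine hG.2 A s t hne ?_
  by_contra! hcon
  obtain ⟨a, ha, b, hab, hbA, hbs, hbt⟩ := hcon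
  rcases hcl' a ha b hab with h1 | h1 | h1 | ⟨rfl, rfl⟩ | ⟨rfl, rfl⟩
  · exact hbA h1
  · exact hbs h1
  · exact hbt h1
  · obtain ⟨x, hx, y, hxy, hy⟩ := h A s t ha hs ht hbA hbs hbt
    have h1 := hcl' x hx y hxy
    grind
  · obtain ⟨x, hx, y, hxy, hy⟩ := h {x | x ∉ A ∧ x ≠ s ∧ x ≠ t} s t ⟨hbA, hbs, hbt⟩ (by simp)
      (by simp) (by simp [ha]) (by grind) (by grind)
    simp only [Set.mem_ofPred_eq, not_and, not_not] at hx hy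
    have h1 := hcl' y
    have h2 := hxy.symm
    grind

/-- If neither the contraction nor the deletion of `zv` is 3-connected, then one of its ends has
degree three, and its other neighbours lie on different sides of any split at `zv`. -/
theorem IsSplit.exists_degree_three {G : SimpleGraph V} (hG : G.TriConn) {z v w : V}
    {F₁ F₂ : Set V} (hF : G.IsSplit z v w F₁ F₂) (h : ¬ (G.deleteEdges {s(z, v)}).TriConn) :
    ∃ p ∈ F₁, ∃ q ∈ F₂, (∀ x, G.Adj v x → x = z ∨ x = p ∨ x = q) ∨
      (∀ x, G.Adj z x → x = v ∨ x = p ∨ x = q) := by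
  obtain ⟨A, p, q, hzA, hpA, hqA, hvA, hvp, hvq, hcl⟩ := exists_cut_of_not_triConn_deleteEdges hG h
  have hcl' : ∀ a, a ∉ A → a ≠ p → a ≠ q → ∀ b, G.Adj a b →
      b ∉ A ∨ (a = v ∧ b = z) := by
    intro a h1 h2 h3 b hab
    have := hcl b
    have := hab.symm
    grind
  -- Besides edges to `p` and `q`, only `zv` leaves `A`. If a side of the split contained neither
  -- `p` nor `q`, its part in `A` would be bounded by `{z, w}` and its part outside by `{v, w}`.
  have key : ∀ E₁ E₂, G.IsSplit z v w E₁ E₂ → p ∈ E₁ ∨ q ∈ E₁ := by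
    intro E₁ E₂ hE
    by_contra! hcon
    obtain ⟨x, hx⟩ := hE.nonempty_left
    have hE1 : ∀ a b, a ∈ E₁ → G.Adj a b → _ := fun a b h1 h2 => hE.cover_left h1 h2
    obtain ⟨-, -, -, hEl, -, hEn, -, -⟩ := hE
    by_cases hxA : x ∈ A
    · refine hG.false_of_cut (A := E₁ ∩ A) z w (x := x) (v := v) ⟨hx, hxA⟩ (fun h => hvA h.2)
        hEn.1.symm hEn.2.2 ?_
      rintro a ⟨ha, haA⟩ b hab
      have h1 := hE1 a b ha hab
      have h2 := hcl a haA b hab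
      simp only [Set.mem_inter_iff]
      grind
    · refine hG.false_of_cut (A := E₁ \ A) v w (x := x) (v := z) ⟨hx, hxA⟩ (fun h => h.2 hzA)
        hEn.1 hEn.2.1 ?_
      rintro a ⟨ha, haA⟩ b hab
      have h1 := hE1 a b ha hab
      have h2 := hcl' a haA (by grind) (by grind) b hab
      simp only [Set.mem_sdiff]
      grind
  have main : ∀ r s, (∀ x, x = p ∨ x = q ↔ x = r ∨ x = s) → r ∈ F₁ → s ∈ F₂ →
      ∃ p ∈ F₁, ∃ q ∈ F₂, (∀ x, G.Adj v x → x = z ∨ x = p ∨ x = q) ∨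
        (∀ x, G.Adj z x → x = v ∨ x = p ∨ x = q) := by
    intro r s hrs hr hs
    refine ⟨r, hr, s, hs, ?_⟩
    have hF1 : ∀ a b, a ∈ F₁ → G.Adj a b → _ := fun a b h1 h2 => hF.cover_left h1 h2
    have hF2 : ∀ a b, a ∈ F₂ → G.Adj a b → _ := fun a b h1 h2 => hF.swap.cover_left h1 h2
    obtain ⟨-, -, hFd, hFl, hFr, hFn, hFc, -⟩ := hF
    have hrF2 := hFd r hr
    have hsF1 : s ∉ F₁ := fun h => hFd s h hs
    have hrA : r ∉ A := by have := hrs r; grind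
    have hsA : s ∉ A := by have := hrs s; grind
    have hvr : v ≠ r := by grind
    have hvs : v ≠ s := by grind
    have hcl2 : ∀ a ∈ A, ∀ b, G.Adj a b → b ∈ A ∨ b = r ∨ b = s ∨ (a = z ∧ b = v) := by
      intro a ha b hab
      have := hcl a ha b hab
      have := hrs b
      tauto
    have hcl3 : ∀ a, a ∉ A → a ≠ r → a ≠ s → ∀ b, G.Adj a b → b ∉ A ∨ (a = v ∧ b = z) := by
      intro a h1 h2 h3
      have := hrs a
      exact hcl' a h1 (by tauto) (by tauto)
    clear hrs hcl hcl' key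
    -- On the side of the deletion cut that misses `w`, both corners are bounded by two vertices and
    -- hence empty. This side shrinks to the single vertex `v` or `z`.
    by_cases hw : w ∈ A
    · left
      have e1 : ∀ x ∈ F₁, x = r ∨ x ∈ A := by
        intro x hx
        by_contra! hcon
        refine hG.false_of_cut (A := {y | y ∈ F₁ ∧ y ∉ A ∧ y ≠ r}) v r (x := x) (v := z)
          ⟨hx, hcon.2, hcon.1⟩ (fun h => h.2.1 hzA) hFn.1 (by grind) ?_
        rintro a ⟨ha, haA, har⟩ b hab
        have h1 := hF1 a b ha hab
        have h2 := hcl3 a haA har (by grind) b hab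
        simp only [Set.mem_ofPred_eq]
        grind
      have e2 : ∀ x ∈ F₂, x = s ∨ x ∈ A := by
        intro x hx
        by_contra! hcon
        refine hG.false_of_cut (A := {y | y ∈ F₂ ∧ y ∉ A ∧ y ≠ s}) v s (x := x) (v := z)
          ⟨hx, hcon.2, hcon.1⟩ (fun h => h.2.1 hzA) hFn.1 (by grind) ?_
        rintro a ⟨ha, haA, har⟩ b hab
        have h1 := hF2 a b ha hab
        have h2 := hcl3 a haA (by grind) har b hab
        simp only [Set.mem_ofPred_eq]
        grind
      intro x hx
      have h1 := hFc x
      have h2 := hcl3 v hvA hvr hvs x hx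
      have := hx.ne
      grind
    · right
      have e1 : ∀ x ∈ F₁, x ∉ A := by
        intro x hx hxA
        refine hG.false_of_cut (A := F₁ ∩ A) z r (x := x) (v := v)
          ⟨hx, hxA⟩ (fun h => hvA h.2) hFn.1.symm hvr ?_
        rintro a ⟨ha, haA⟩ b hab
        have h1 := hF1 a b ha hab
        have h2 := hcl2 a haA b hab
        simp only [Set.mem_inter_iff]
        grind
      have e2 : ∀ x ∈ F₂, x ∉ A := by
        intro x hx hxA
        refine hG.false_of_cut (A := F₂ ∩ A) z s (x := x) (v := v)
          ⟨hx, hxA⟩ (fun h => hvA h.2) hFn.1.symm hvs ?_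
        rintro a ⟨ha, haA⟩ b hab
        have h1 := hF2 a b ha hab
        have h2 := hcl2 a haA b hab
        simp only [Set.mem_inter_iff]
        grind
      intro x hx
      have h1 := hFc x
      have h2 := hcl2 z hzA x hx
      have := hx.ne
      grind
  have h1 := hF.disjoint p
  have h2 := hF.disjoint q
  rcases key _ _ hF with h | h <;> rcases key _ _ hF.swap with h' | h'
  · exact (h1 h h').elim
  · exact main p q (by tauto) h h'
  · exact main q p (by tauto) h h'
  · exact (h2 h h').elim

/-! ### Contractions -/

/-- The graph that arises from `G` by contracting `e`. -/
abbrev contract (G : SimpleGraph V) (e : Sym2 V) : SimpleGraph (ConstraintGraph.ContractVert e) :=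
  G.map (Quot.mk _)

theorem contractVert_mk_eq_iff {e : Sym2 V} {x y : V} :
    (Quot.mk _ x : ConstraintGraph.ContractVert e) = Quot.mk _ y ↔ x = y ∨ s(x, y) = e := by
  refine ⟨fun h => ?_, ?_⟩
  · have h' := Quot.eqvGen_exact h
    clear h
    induction h' with
    | rel _ _ h => exact Or.inr h
    | refl => exact Or.inl rfl
    | symm _ _ _ ih => rwa [eq_comm, Sym2.eq_swap]
    | trans _ _ _ _ _ ih1 ih2 =>
      rcases ih1 with rfl | ih1 <;> rcases ih2 with rfl | ih2
      · exact Or.inl rfl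
      · exact Or.inr ih2
      · exact Or.inr ih1
      · rw [← ih2, Sym2.eq_iff] at ih1
        left
        grind
  · rintro (rfl | h)
    · rfl
    · exact Quot.sound h

theorem contract_adj {G : SimpleGraph V} {e : Sym2 V} {x y : V} (h : G.Adj x y)
    (he : s(x, y) ≠ e) : (G.contract e).Adj (Quot.mk _ x) (Quot.mk _ y) := by
  refine ⟨?_, x, y, h, rfl, rfl⟩
  intro h'
  rcases contractVert_mk_eq_iff.1 h' with h' | h'
  · exact h.ne h'
  · exact he h'

/-- A separator of two vertices in the contraction must contain the contracted vertex, as otherwise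
it would separate `G`. Replacing that vertex by `u` and `v` gives the split. Five vertices are
needed for the contraction to have four. -/
theorem exists_isSplit_of_not_triConn_contract {G : SimpleGraph V} (hG : G.TriConn)
    (h5 : ∀ p q r s : V, ∃ x, x ≠ p ∧ x ≠ q ∧ x ≠ r ∧ x ≠ s) {u v : V} (huv : u ≠ v)
    (h : ¬ (G.contract s(u, v)).TriConn) : ∃ w F₁ F₂, G.IsSplit u v w F₁ F₂ := by
  classical
  by_contra! hcon
  have hmk : ∀ x y : V, (Quot.mk _ x : ConstraintGraph.ContractVert s(u, v)) = Quot.mk _ y ↔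
      x = y ∨ (x = u ∧ y = v) ∨ (x = v ∧ y = u) := by
    intro x y
    rw [contractVert_mk_eq_iff, Sym2.eq_iff]
  refine h (triConn_of_forall_notMem ?_ ?_)
  · rintro ⟨r⟩ ⟨s⟩ ⟨t⟩
    -- If `u` is among `r, s, t`, the contracted vertex is taken and `x` has to avoid `v` as well.
    -- Otherwise avoiding `u` suffices: `x = v` then means that neither end is among them.
    obtain ⟨x, h1, h2, h3, h4⟩ := h5 r s t (if r = u ∨ s = u ∨ t = u then v else u)
    by_cases hx : x = u ∨ x = v
    · have hne : ∀ y ∈ [r, s, t], ((Quot.mk _ x : ConstraintGraph.ContractVert s(u, v)) ≠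
          Quot.mk _ y) := by
        intro y hy hxy
        have := (hmk _ _).1 hxy
        simp only [List.mem_cons, List.not_mem_nil, or_false] at hy
        grind
      exact ⟨Quot.mk _ x, hne r (by simp), hne s (by simp), hne t (by simp)⟩
    · refine ⟨Quot.mk _ x, ?_, ?_, ?_⟩ <;> rw [Ne, hmk] <;> grind
  · rintro A' ⟨s⟩ ⟨t⟩ ⟨⟨x⟩, hx⟩ hs ht hcl ⟨y⟩
    let A : Set V := {a | (Quot.mk _ a : ConstraintGraph.ContractVert s(u, v)) ∈ A'}
    have hA : ∀ a, a ∈ A ↔ (Quot.mk _ a : ConstraintGraph.ContractVert s(u, v)) ∈ A' :=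
      fun _ => Iff.rfl
    have huvA : u ∈ A ↔ v ∈ A := by rw [hA, hA, (hmk u v).2 (by simp)]
    have hcl' : ∀ a ∈ A, ∀ b, G.Adj a b → b ∈ A ∨ (b = s ∨ (b = u ∧ s = v) ∨ (b = v ∧ s = u)) ∨
        (b = t ∨ (b = u ∧ t = v) ∨ (b = v ∧ t = u)) := by
      intro a ha b hab
      by_cases he : s(a, b) = s(u, v)
      · rw [Sym2.eq_iff] at he
        left
        grind
      · have := hcl _ ha _ (contract_adj hab he)
        rwa [hmk, hmk] at this
    change s ∉ A at hs
    change t ∉ A at ht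
    change x ∈ A at hx
    change y ∈ A ∨ _ ∨ _
    rw [hmk, hmk]
    clear hA hmk hcl
    have key : ∀ r, r ∉ A → u ∉ A →
        (∀ a ∈ A, ∀ b, G.Adj a b → b ∈ A ∨ b = u ∨ b = v ∨ b = r) →
        y ∈ A ∨ y = u ∨ y = v ∨ y = r := by
      intro r hr hu hrcl
      by_cases hr' : r = u ∨ r = v
      · have := hG.2 A u v ⟨x, hx⟩ (by grind) y
        tauto
      · by_contra! hy
        refine hcon r A {z | z ∉ A ∧ z ≠ u ∧ z ≠ v ∧ z ≠ r} ⟨⟨x, hx⟩, ⟨y, hy⟩, ?_, ?_, ?_, ?_, ?_, ?_⟩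
        · exact fun z hz hz' => hz'.1 hz
        · tauto
        · simp
        · refine ⟨huv, ?_⟩
          grind
        · intro z
          simp only [Set.mem_ofPred_eq]
          tauto
        · intro a ha b hb hab
          have := hrcl a ha b hab
          simp only [Set.mem_ofPred_eq] at hb
          tauto
    by_cases hsu : s = u ∨ s = v
    · have := key t ht (by grind) (by grind)
      grind
    · by_cases htu : t = u ∨ t = v
      · have := key s hs (by grind) (by grind)
        grind
      · have := hG.2 A s t ⟨x, hx⟩ (by grind) y
        grind

/-- If neither deleting `zv` nor contracting an edge at `z` keeps the graph 3-connected, then `v`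
has degree three, `z` has larger degree, and the other two edges at `v` can be contracted. -/
theorem TriConn.exists_contract {G : SimpleGraph V} (hG : G.TriConn)
    (h5 : ∀ p q r s : V, ∃ x, x ≠ p ∧ x ≠ q ∧ x ≠ r ∧ x ≠ s) {z v : V} (hzv : G.Adj z v)
    (hdel : ¬ (G.deleteEdges {s(z, v)}).TriConn)
    (hcon : ∀ p, G.Adj z p → ¬ (G.contract s(z, p)).TriConn) :
    ∃ p q, p ≠ q ∧ p ≠ z ∧ q ≠ z ∧ G.Adj v p ∧ G.Adj v q ∧
      (∀ x, G.Adj v x → x = z ∨ x = p ∨ x = q) ∧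
      (G.contract s(v, p)).TriConn ∧ (G.contract s(v, q)).TriConn ∧
      ∀ s t, ∃ x, G.Adj z x ∧ x ≠ v ∧ x ≠ s ∧ x ≠ t := by
  obtain ⟨w, F₁, F₂, hF⟩ := exists_isSplit_of_not_triConn_contract hG h5 hzv.ne (hcon v hzv)
  obtain ⟨p, hp, q, hq, hN⟩ := hF.exists_degree_three hG hdel
  have hpq : p ≠ q := fun h => hF.disjoint p hp (h ▸ hq)
  have hdeg : ∀ {x a b c : V}, (∀ y, G.Adj x y → y = a ∨ y = b ∨ y = c) →
      G.Adj x a ∧ G.Adj x b ∧ G.Adj x c := by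
    intro x a b c h
    obtain ⟨y1, h11, h12, h13⟩ := hG.exists_adj_ne x b c
    obtain ⟨y2, h21, h22, h23⟩ := hG.exists_adj_ne x a c
    obtain ⟨y3, h31, h32, h33⟩ := hG.exists_adj_ne x a b
    have := h y1 h11
    have := h y2 h21
    have := h y3 h31
    grind
  -- Otherwise `zp` and `zq` are not contractible either, and `third_adj` with `z` and `v` exchanged
  -- makes `p, q` the other neighbours of `v`, too. Then `{p, q}` separates `{z, v}` from `w`.
  have hz3 : ∀ p' ∈ F₁, ∀ q' ∈ F₂, ¬ ∀ x, G.Adj z x → x = v ∨ x = p' ∨ x = q' := by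
    intro p hp q hq hN
    have hpq : p ≠ q := fun h => hF.disjoint p hp (h ▸ hq)
    obtain ⟨-, hzp, hzq⟩ := hdeg hN
    obtain ⟨t, D₁, D₂, hD⟩ := exists_isSplit_of_not_triConn_contract hG h5 hzp.ne (hcon p hzp)
    obtain ⟨t', D₁', D₂', hD'⟩ := exists_isSplit_of_not_triConn_contract hG h5 hzq.ne (hcon q hzq)
    obtain ⟨-, h1⟩ := hF.symm.third_adj hG hp hq hN hD
    obtain ⟨-, h2⟩ := hF.symm.swap.third_adj hG hq hp (fun x hx => by have := hN x hx; tauto) hD'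
    have h3 := hdeg h1
    have h4 := hdeg h2
    have hqt : q = t := by
      have := h1 q h4.2.1
      have := hF.notMem_right
      grind
    subst hqt
    refine hG.false_of_cut (A := {z, v}) p q (x := z) (v := w) (by simp) ?_ ?_ ?_ ?_
    · have := hF.ne
      grind
    · have := hF.notMem_left
      grind
    · have := hF.notMem_right
      grind
    · rintro a (rfl | rfl) b hab
      · have := hN b hab
        grind
      · have := h1 b hab
        grind
  rcases hN with hN | hN
  swap
  · exact (hz3 p hp q hq hN).elim
  obtain ⟨-, hvp, hvq⟩ := hdeg hN
  refine ⟨p, q, hpq, ?_, ?_, hvp, hvq, hN, ?_, ?_, ?_⟩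
  · have := hF.notMem_left
    grind
  · have := hF.notMem_right
    grind
  · by_contra hc
    obtain ⟨t, D₁, D₂, hD⟩ := exists_isSplit_of_not_triConn_contract hG h5 hvp.ne hc
    obtain ⟨ht, h1⟩ := hF.third_adj hG hp hq hN hD
    exact hz3 p hp t ht h1
  · by_contra hc
    obtain ⟨t, D₁, D₂, hD⟩ := exists_isSplit_of_not_triConn_contract hG h5 hvq.ne hc
    obtain ⟨ht, h1⟩ := hF.swap.third_adj hG hq hp (fun x hx => by have := hN x hx; tauto) hD
    exact hz3 t ht q hq fun x hx => by have := h1 x hx; tauto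
  -- `z` has neighbours on both sides of the split, so if `s, t` were its only ones besides `v`,
  -- they would lie on different sides, against `hz3`.
  · intro s t
    by_contra! hc
    have hst : ∀ x, G.Adj z x → x = v ∨ x = s ∨ x = t := fun x hx => by have := hc x hx; tauto
    have key : ∀ E₁ E₂, G.IsSplit z v w E₁ E₂ → s ∈ E₁ ∨ t ∈ E₁ := by
      intro E₁ E₂ hE
      by_contra! hcon
      obtain ⟨x, hx⟩ := hE.nonempty_left
      refine hG.false_of_cut (A := E₁) v w (x := x) (v := z) hx hE.notMem_left.1 hE.ne.1
        hE.ne.2.1 ?_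
      intro a ha b hab
      have h1 := hE.cover_left ha hab
      have h2 := hst a
      have h3 := hab.symm
      have h4 := hE.notMem_left
      grind
    have h1 := hF.disjoint s
    have h2 := hF.disjoint t
    rcases key _ _ hF with h | h <;> rcases key _ _ hF.swap with h' | h'
    · exact h1 h h'
    · exact hz3 s h t h' hst
    · exact hz3 t h s h' fun x hx => by have := hst x hx; tauto
    · exact h2 h h'

end SimpleGraph

/-! ### Connectedness and size under contraction -/

namespace SimpleGraph

variable {V : Type*}

theorem ConnSet.contract {G : SimpleGraph V} {A : Set V} (hA : G.ConnSet A) (e : Sym2 V) :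
    (G.contract e).ConnSet (Quot.mk _ '' A) := by
  refine ⟨hA.1.image _, fun B hB ⟨b, hb⟩ hcl => ?_⟩
  have h : A ⊆ {a | a ∈ A ∧ (Quot.mk _ a : ConstraintGraph.ContractVert e) ∈ B} := by
    refine hA.2 _ (fun a ha => ha.1) ?_ ?_
    · obtain ⟨a, ha, rfl⟩ := hB hb
      exact ⟨a, ha, hb⟩
    · rintro x ⟨hx, hxB⟩ a ha hxa
      refine ⟨ha, ?_⟩
      by_cases he : s(x, a) = e
      · rwa [← contractVert_mk_eq_iff.2 (Or.inr he)]
      · exact hcl _ hxB _ ⟨a, ha, rfl⟩ (contract_adj hxa he)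
  rintro _ ⟨a, ha, rfl⟩
  exact (h ha).2

theorem card_contractVert_lt [Finite V] {u v : V} (h : u ≠ v) :
    Nat.card (ConstraintGraph.ContractVert s(u, v)) < Nat.card V := by
  refine lt_of_le_of_ne (Nat.card_le_card_of_surjective (Quot.mk _) Quot.mk_surjective) fun hc => ?_
  have hinj : Function.Injective (Quot.mk fun x y : V => s(x, y) = s(u, v)) :=
    (Function.Surjective.bijective_of_nat_card_le Quot.mk_surjective hc.ge).1
  exact h (hinj (Quot.sound rfl))

theorem ncard_edgeSet_contract_le [Finite V] (G : SimpleGraph V) (e : Sym2 V) :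
    (G.contract e).edgeSet.ncard ≤ G.edgeSet.ncard := by
  refine (Set.ncard_le_ncard ?_ (Set.toFinite _)).trans
    (Set.ncard_image_le (f := Sym2.map (Quot.mk _)) (Set.toFinite G.edgeSet))
  intro f hf
  induction f using Sym2.ind with
  | _ x y =>
    obtain ⟨-, a, b, hab, rfl, rfl⟩ := hf
    exact ⟨s(a, b), hab, rfl⟩

theorem ncard_edgeSet_deleteEdges_lt [Finite V] {G : SimpleGraph V} {e : Sym2 V}
    (he : e ∈ G.edgeSet) : (G.deleteEdges {e}).edgeSet.ncard < G.edgeSet.ncard := by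
  rw [edgeSet_deleteEdges]
  exact Set.ncard_sdiff_singleton_lt_of_mem he

end SimpleGraph

/-! ### Constraint cuts, and constraint minors from branch sets -/

namespace ConstraintGraph

universe u v

variable {V : Type u}

/-- The graph formed by the edges of the constraint. -/
def constraintGraph (C : ConstraintGraph V) : SimpleGraph V where
  Adj a b := s(a, b) ∈ C.constraint
  symm := ⟨fun a b h => by rwa [Sym2.eq_swap]⟩
  loopless := ⟨fun a h => (C.constraint_subset h).ne rfl⟩

theorem constraintGraph_le (C : ConstraintGraph V) : C.constraintGraph ≤ C.graph :=
  fun _ _ h => C.constraint_subset h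

/-- A bipartition of the vertices that no edge of the constraint crosses, with an edge of the
constraint on either side. -/
def IsConstraintCut (C : ConstraintGraph V) (S : Set V) : Prop :=
  (∀ a ∈ S, ∀ b, C.constraintGraph.Adj a b → b ∈ S) ∧
    (∃ a ∈ S, ∃ b, C.constraintGraph.Adj a b) ∧ ∃ a ∉ S, ∃ b, C.constraintGraph.Adj a b

theorem isConstraintConnected_iff (C : ConstraintGraph V) :
    C.IsConstraintConnected ↔ ¬ ∃ S, C.IsConstraintCut S := by
  constructor
  · rintro (h | h) ⟨S, hS, ⟨a, ha, b, hab⟩, ⟨c, hc, d, hcd⟩⟩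
    · have hab : s(a, b) ∈ C.constraint := hab
      simp [h] at hab
    · exact hc (h.coe.eq_univ_of_closed (A := {x | x.1 ∈ S})
        ⟨⟨a, s(a, b), hab, Sym2.mem_mk_left a b⟩, ha⟩ (fun x hx y hxy => hS _ hx _ hxy)
        ⟨c, s(c, d), hcd, Sym2.mem_mk_left c d⟩)
  · intro h
    by_contra hcon
    simp only [IsConstraintConnected, not_or] at hcon
    obtain ⟨he, hcon⟩ := hcon
    obtain ⟨e, he⟩ := Set.nonempty_iff_ne_empty.2 he
    induction e using Sym2.ind with
    | _ a b =>
      have : Nonempty C.spanned.verts := ⟨⟨a, s(a, b), he, Sym2.mem_mk_left a b⟩⟩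
      refine hcon ⟨SimpleGraph.Connected.mk ?_⟩
      have key : ∀ x : C.spanned.verts, C.spanned.coe.Reachable ⟨a, s(a, b), he,
          Sym2.mem_mk_left a b⟩ x := by
        intro x
        by_contra hx
        refine h ⟨{y | ∃ hy : y ∈ C.spanned.verts, C.spanned.coe.Reachable ⟨a, s(a, b), he,
          Sym2.mem_mk_left a b⟩ ⟨y, hy⟩}, ?_, ?_, ?_⟩
        · rintro y ⟨hy, hay⟩ z hyz
          have hz : z ∈ C.spanned.verts := ⟨s(y, z), hyz, Sym2.mem_mk_right y z⟩
          refine ⟨hz, hay.trans (SimpleGraph.Adj.reachable ?_)⟩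
          exact hyz
        · exact ⟨a, ⟨_, SimpleGraph.Reachable.refl _⟩, b, he⟩
        · refine ⟨x.1, fun ⟨_, hx'⟩ => hx hx', ?_⟩
          obtain ⟨⟨x, e, he, hxe⟩, -⟩ := x, trivial
          obtain ⟨y, rfl⟩ := hxe
          exact ⟨y, he⟩
      exact fun x y => (key x).symm.trans (key y)

theorem mem_contractEdge_constraint {C : ConstraintGraph V} {e : Sym2 V} {x y : V}
    (hxy : C.constraintGraph.Adj x y) (he : s(x, y) ≠ e) :
    (C.contractEdge e).constraintGraph.Adj (Quot.mk _ x) (Quot.mk _ y) := by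
  refine ⟨?_, s(x, y), hxy, rfl⟩
  rw [Sym2.mk_isDiag_iff, SimpleGraph.contractVert_mk_eq_iff, not_or]
  exact ⟨hxy.ne, he⟩

theorem exists_of_mem_contractEdge_constraint {C : ConstraintGraph V} {e : Sym2 V}
    {p q : ContractVert e} (h : (C.contractEdge e).constraintGraph.Adj p q) :
    ∃ x y, C.constraintGraph.Adj x y ∧ Quot.mk _ x = p ∧ Quot.mk _ y = q := by
  obtain ⟨-, f, hf, hfe⟩ := h
  induction f using Sym2.ind with
  | _ x y =>
    rw [Sym2.map_mk, Sym2.eq_iff] at hfe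
    rcases hfe with ⟨h1, h2⟩ | ⟨h1, h2⟩
    · exact ⟨x, y, hf, h1, h2⟩
    · exact ⟨y, x, SimpleGraph.Adj.symm (G := C.constraintGraph) hf, h2, h1⟩

/-- A constraint cut of a constraint minor comes from a constraint cut. -/
theorem IsConstraintMinorOf.exists_isConstraintCut {W : Type v} {D : ConstraintGraph W}
    {S : Set W} (hS : D.IsConstraintCut S) {C : ConstraintGraph V}
    (h : D.IsConstraintMinorOf C) : ∃ T, C.IsConstraintCut T := by
  induction h with
  | iso C h =>
    obtain ⟨φ, hφ⟩ := h
    have hadj : ∀ a b, C.constraintGraph.Adj a b ↔ D.constraintGraph.Adj (φ a) (φ b) := by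
      intro a b
      change _ ↔ s(φ a, φ b) ∈ D.constraint
      rw [← hφ, ← Sym2.map_mk, (Sym2.map.injective φ.injective).mem_set_image]
      rfl
    obtain ⟨h1, ⟨a, ha, b, hab⟩, ⟨c, hc, d, hcd⟩⟩ := hS
    refine ⟨φ ⁻¹' S, fun a ha b hab => h1 _ ha _ ((hadj _ _).1 hab),
      ⟨φ.symm a, by simpa using ha, φ.symm b, by rw [hadj]; simpa using hab⟩,
      ⟨φ.symm c, by simpa using hc, φ.symm d, by rw [hadj]; simpa using hcd⟩⟩
  | delete C e he heX h ih => exact ih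
  | contract C e he h ih =>
    obtain ⟨T, h1, ⟨a, ha, b, hab⟩, ⟨c, hc, d, hcd⟩⟩ := ih
    obtain ⟨a, b, hab', rfl, rfl⟩ := exists_of_mem_contractEdge_constraint hab
    obtain ⟨c, d, hcd', rfl, rfl⟩ := exists_of_mem_contractEdge_constraint hcd
    refine ⟨Quot.mk _ ⁻¹' T, fun x hx y hxy => ?_, ⟨a, ha, b, hab'⟩, ⟨c, hc, d, hcd'⟩⟩
    by_cases he : s(x, y) = e
    · have : (Quot.mk _ x : ContractVert e) = Quot.mk _ y :=
        SimpleGraph.contractVert_mk_eq_iff.2 (Or.inr he)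
      rwa [Set.mem_preimage, ← this]
    · exact h1 _ hx _ (mem_contractEdge_constraint hxy he)

theorem isConstraintMinorOf_of_injective {W : Type v} {D : ConstraintGraph W}
    {C : ConstraintGraph V} {f : V → W} (hf : Function.Bijective f)
    (hD : ∀ x y, D.graph.Adj x y → ∃ a b, C.graph.Adj a b ∧ f a = x ∧ f b = y)
    (hX : ∀ x y, D.constraintGraph.Adj x y → ∃ a b, C.constraintGraph.Adj a b ∧ f a = x ∧ f b = y)
    (hX' : ∀ a b, C.constraintGraph.Adj a b → f a = f b ∨ D.constraintGraph.Adj (f a) (f b))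
    (h : ∀ a b, C.graph.Adj a b → D.graph.Adj (f a) (f b)) : D.IsConstraintMinorOf C := by
  refine .iso C ⟨⟨Equiv.ofBijective f hf, ?_⟩, ?_⟩
  · intro a b
    refine ⟨fun hab => ?_, h a b⟩
    obtain ⟨a', b', hab', ha, hb⟩ := hD _ _ hab
    rwa [← hf.1 ha, ← hf.1 hb]
  · ext e
    constructor
    · rintro ⟨x, hx, rfl⟩
      induction x using Sym2.ind with
      | _ a b => exact (hX' a b hx).resolve_left fun h => (C.constraint_subset hx).ne (hf.1 h)
    · intro he
      induction e using Sym2.ind with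
      | _ x y =>
        obtain ⟨a, b, hab, rfl, rfl⟩ := hX x y he
        exact ⟨s(a, b), hab, rfl⟩

/-- A constraint minor given by connected branch sets that cover all vertices. -/
theorem isConstraintMinorOf_of_map {W : Type v} [Finite V] {D : ConstraintGraph W}
    {C : ConstraintGraph V} (f : V → W) (hconn : ∀ w, C.graph.ConnSet (f ⁻¹' {w}))
    (hD : ∀ x y, D.graph.Adj x y → ∃ a b, C.graph.Adj a b ∧ f a = x ∧ f b = y)
    (hX : ∀ x y, D.constraintGraph.Adj x y → ∃ a b, C.constraintGraph.Adj a b ∧ f a = x ∧ f b = y)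
    (hX' : ∀ a b, C.constraintGraph.Adj a b → f a = f b ∨ D.constraintGraph.Adj (f a) (f b)) :
    D.IsConstraintMinorOf C := by
  induction hn : Nat.card V + C.graph.edgeSet.ncard using Nat.strong_induction_on
    generalizing V with
  | _ n ih =>
    subst hn
    -- As long as a branch set has two vertices, one of its edges can be contracted. Once `f` is
    -- bijective, the surplus edges are deleted; they lie outside the constraint by `hX'`.
    by_cases hf : Function.Injective f
    · have hbij : Function.Bijective f := ⟨hf, fun w => (hconn w).1⟩
      by_cases hE : ∀ a b, C.graph.Adj a b → D.graph.Adj (f a) (f b)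
      · exact isConstraintMinorOf_of_injective hbij hD hX hX' hE
      push Not at hE
      obtain ⟨a, b, hab, hDab⟩ := hE
      have hnX : s(a, b) ∉ C.constraint := by
        intro h
        rcases hX' a b h with h | h
        · exact hab.ne (hf h)
        · exact hDab (D.constraint_subset h)
      refine .delete C s(a, b) hab hnX (ih _ ?_ (C := C.deleteEdge s(a, b) hnX) f ?_ ?_ hX hX' rfl)
      · have : (C.deleteEdge s(a, b) hnX).graph.edgeSet.ncard < C.graph.edgeSet.ncard :=
          SimpleGraph.ncard_edgeSet_deleteEdges_lt hab
        lia
      · intro w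
        obtain ⟨v, rfl⟩ := hbij.2 w
        rw [show f ⁻¹' {f v} = {v} by ext x; simp [hf.eq_iff]]
        exact SimpleGraph.connSet_singleton _ _
      · intro x y hxy
        obtain ⟨c, d, hcd, rfl, rfl⟩ := hD x y hxy
        refine ⟨c, d, ?_, rfl, rfl⟩
        change (C.graph.deleteEdges {s(a, b)}).Adj c d
        rw [SimpleGraph.deleteEdges_adj]
        refine ⟨hcd, fun he => hDab ?_⟩
        rcases Sym2.eq_iff.1 he with ⟨rfl, rfl⟩ | ⟨rfl, rfl⟩
        · exact hxy
        · exact hxy.symm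
    · simp only [Function.Injective, not_forall] at hf
      obtain ⟨x, y, hxy, hne⟩ := hf
      obtain ⟨a, ha, b, hb, hab, hadj⟩ := (hconn (f y)).exists_adj (B := {x})
        (by simpa using hxy) ⟨x, rfl⟩ (x := y) rfl (by simpa using Ne.symm hne)
      have ha : a = x := ha
      subst ha
      have hlift : ∀ p q : V, s(p, q) = s(a, b) → f p = f q := by
        have hb : f b = f y := hb
        intro p q hpq
        rcases Sym2.eq_iff.1 hpq with ⟨rfl, rfl⟩ | ⟨rfl, rfl⟩
        · rw [hxy, hb]
        · rw [hxy, hb]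
      refine .contract C s(a, b) hadj (ih _ ?_ (C := C.contractEdge s(a, b)) (Quot.lift f hlift)
        ?_ ?_ ?_ ?_ rfl)
      · have h1 : (C.contractEdge s(a, b)).graph.edgeSet.ncard ≤ C.graph.edgeSet.ncard :=
          SimpleGraph.ncard_edgeSet_contract_le _ _
        have h2 := SimpleGraph.card_contractVert_lt hadj.ne
        lia
      · intro w
        suffices h : Quot.lift f hlift ⁻¹' {w} = Quot.mk _ '' (f ⁻¹' {w}) from
          h ▸ (hconn w).contract s(a, b)
        ext ⟨v⟩
        constructor
        · exact fun hv => ⟨v, hv, rfl⟩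
        · rintro ⟨v', hv', hvv⟩
          rw [← hvv]
          exact hv'
      · intro p q hpq
        obtain ⟨c, d, hcd, rfl, rfl⟩ := hD p q hpq
        refine ⟨_, _, SimpleGraph.contract_adj hcd fun he => hpq.ne (hlift _ _ he), rfl, rfl⟩
      · intro p q hpq
        obtain ⟨c, d, hcd, rfl, rfl⟩ := hX p q hpq
        exact ⟨_, _, mem_contractEdge_constraint hcd fun he => hpq.ne (hlift _ _ he), rfl, rfl⟩
      · intro p q hpq
        obtain ⟨c, d, hcd, rfl, rfl⟩ := exists_of_mem_contractEdge_constraint hpq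
        exact hX' c d hcd

theorem isConstraintMinorOf_of_family {W : Type v} [Finite V] {D : ConstraintGraph W}
    {C : ConstraintGraph V} (F : W → Set V) (hcover : ∀ v, ∃ w, v ∈ F w)
    (hdisj : ∀ w w' v, v ∈ F w → v ∈ F w' → w = w') (hconn : ∀ w, C.graph.ConnSet (F w))
    (hD : ∀ x y, D.graph.Adj x y → ∃ a ∈ F x, ∃ b ∈ F y, C.graph.Adj a b)
    (hX : ∀ x y, D.constraintGraph.Adj x y → ∃ a ∈ F x, ∃ b ∈ F y, C.constraintGraph.Adj a b)
    (hX' : ∀ x y, ∀ a ∈ F x, ∀ b ∈ F y, C.constraintGraph.Adj a b →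
      x = y ∨ D.constraintGraph.Adj x y) :
    D.IsConstraintMinorOf C := by
  choose f hf using hcover
  have hf' : ∀ w v, v ∈ F w → f v = w := fun w v h => hdisj _ _ v (hf v) h
  refine isConstraintMinorOf_of_map f (fun w => ?_) ?_ ?_ (fun a b => hX' _ _ _ (hf a) _ (hf b))
  · convert hconn w using 1
    ext v
    exact ⟨fun h => h ▸ hf v, hf' w v⟩
  · intro x y hxy
    obtain ⟨a, ha, b, hb, hab⟩ := hD x y hxy
    exact ⟨a, b, hab, hf' _ _ ha, hf' _ _ hb⟩
  · intro x y hxy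
    obtain ⟨a, ha, b, hb, hab⟩ := hX x y hxy
    exact ⟨a, b, hab, hf' _ _ ha, hf' _ _ hb⟩

/-! ### The six obstructions have disconnected constraints -/

theorem isConstraintCut_constraintK4 : constraintK4.IsConstraintCut {0, 1} := by
  simp [IsConstraintCut, constraintGraph, constraintK4, Fin.forall_fin_succ, Fin.exists_fin_succ]

theorem isConstraintCut_constraintWheel : constraintWheel.IsConstraintCut {0, 1} := by
  simp [IsConstraintCut, constraintGraph, constraintWheel, Fin.forall_fin_succ,
    Fin.exists_fin_succ]

theorem isConstraintCut_constraintPrism₁ : constraintPrism₁.IsConstraintCut {0, 1, 2} := by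
  simp [IsConstraintCut, constraintGraph, constraintPrism₁, Fin.forall_fin_succ,
    Fin.exists_fin_succ]

theorem isConstraintCut_constraintPrism₂ : constraintPrism₂.IsConstraintCut {0, 1, 2} := by
  simp [IsConstraintCut, constraintGraph, constraintPrism₂, Fin.forall_fin_succ,
    Fin.exists_fin_succ]

theorem isConstraintCut_constraintPrism₃ : constraintPrism₃.IsConstraintCut {0, 1, 2} := by
  simp [IsConstraintCut, constraintGraph, constraintPrism₃, Fin.forall_fin_succ,
    Fin.exists_fin_succ]

theorem isConstraintCut_constraintPrism₄ : constraintPrism₄.IsConstraintCut {0, 1, 2} := by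
  simp [IsConstraintCut, constraintGraph, constraintPrism₄, Fin.forall_fin_succ,
    Fin.exists_fin_succ]

end ConstraintGraph

/-! ### Rooted triangles in sets without cutvertices -/

namespace SimpleGraph

variable {V : Type*}

/-- A separator outside `W` removes nothing, so any vertex of `Q` can replace it. -/
theorem SeparatedBy.exists_mem {G : SimpleGraph V} {W P Q : Set V} {s : V}
    (h : G.SeparatedBy W P Q s) (hP : P ⊆ W) (hQ : Q ⊆ W) (hne : Q.Nonempty) :
    ∃ r ∈ W, G.SeparatedBy W P Q r := by
  by_cases hs : s ∈ W
  · exact ⟨s, hs, h⟩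
  · obtain ⟨q, hq⟩ := hne
    obtain ⟨A, hA, hsA, hcl, hPA, hQA⟩ := h
    exact ⟨q, hQ hq, A, hA, hQA q hq, by grind, by grind, hQA⟩

/-- In a set without cutvertices, any three vertices can be extended to a partition into three
connected, pairwise adjacent parts. -/
theorem exists_rooted_triangle [Finite V] {G : SimpleGraph V} {U : Set V}
    (hU : ∀ u ∈ U, G.ConnSet (U \ {u})) (u : Fin 3 → V) (hu : Function.Injective u)
    (huU : ∀ i, u i ∈ U) :
    ∃ A : Fin 3 → Set V, (∀ i, u i ∈ A i) ∧ (∀ i, G.ConnSet (A i)) ∧ (∀ i, A i ⊆ U) ∧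
      (∀ x ∈ U, ∃ i, x ∈ A i) ∧ (∀ i j x, x ∈ A i → x ∈ A j → i = j) ∧
      ∀ i j, i ≠ j → ∃ a ∈ A i, ∃ b ∈ A j, G.Adj a b := by
  have h01 : u 0 ≠ u 1 := hu.ne (by decide)
  have h02 : u 0 ≠ u 2 := hu.ne (by decide)
  have h12 : u 1 ≠ u 2 := hu.ne (by decide)
  -- Menger away from `u 2`, between its neighbourhood and `{u 0, u 1}`; a separator would be a
  -- cutvertex of `U`. The two linking sets grow to a bipartition of `U \ {u 2}`, and `{u 2}` is the
  -- third part.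
  have hL : G.Linked (U \ {u 2}) {x | x ∈ U ∧ G.Adj (u 2) x} {u 0, u 1} := by
    refine linked_of_not_separatedBy ?_ ?_ ?_ ?_
    · rintro x ⟨hx, hux⟩
      exact ⟨hx, hux.ne'⟩
    · have := huU 0
      have := huU 1
      grind
    · obtain ⟨b, hb, a, ha, hab, hadj⟩ := (hU (u 0) (huU 0)).exists_adj (B := {u 2})
        (by have := huU 2; grind) ⟨_, rfl⟩ (x := u 1) ⟨huU 1, by simpa using h01.symm⟩
        (by simpa using h12)
      obtain rfl : b = u 2 := hb
      exact ⟨a, ha.1, hadj⟩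
    · intro s' hs'
      obtain ⟨s, hsU, A, hA, hsA, hcl, hP, hQ⟩ := hs'.exists_mem (fun x hx => ⟨hx.1, hx.2.ne'⟩) (by
        have := huU 0
        grind) ⟨u 0, by simp⟩
      obtain ⟨x, hx, hxs⟩ : ∃ x, (x = u 0 ∨ x = u 1) ∧ x ≠ s := by
        by_cases h : u 0 = s
        · exact ⟨u 1, by simp, by grind⟩
        · exact ⟨u 0, by simp, h⟩
      have hxU : x ∈ U := by rcases hx with rfl | rfl <;> exact huU _
      obtain ⟨b, hb, a, ha, hab, hadj⟩ := (hU s hsU.1).exists_adj (B := insert (u 2) A)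
        (by have := huU 2; grind) ⟨u 2, by simp⟩ (x := x) ⟨hxU, hxs⟩ (by grind)
      have h1 := hP a
      have h2 := hcl b
      grind
  obtain ⟨C, D, hC, hD, hCD, hCc, hDc, hCP, hCQ, hDP, hDQ⟩ := hL
  obtain ⟨C, D, hC, hD, hCD, hCc, hDc, ⟨c, hc, -, huc⟩, ⟨d, hd, -, hud⟩, h0, h1⟩ :
      ∃ C D, C ⊆ U \ {u 2} ∧ D ⊆ U \ {u 2} ∧ Disjoint C D ∧ G.ConnSet C ∧ G.ConnSet D ∧
      (C ∩ {x | x ∈ U ∧ G.Adj (u 2) x}).Nonempty ∧ (D ∩ {x | x ∈ U ∧ G.Adj (u 2) x}).Nonempty ∧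
      u 0 ∈ C ∧ u 1 ∈ D := by
    obtain ⟨x, hxC, hx⟩ := hCQ
    obtain ⟨y, hyD, hy⟩ := hDQ
    have hdj := Set.disjoint_left.1 hCD
    simp only [Set.mem_insert_iff, Set.mem_singleton_iff] at hx hy
    rcases hx with rfl | rfl <;> rcases hy with rfl | rfl
    · exact (hdj hxC hyD).elim
    · exact ⟨C, D, hC, hD, hCD, hCc, hDc, hCP, hDP, hxC, hyD⟩
    · exact ⟨D, C, hD, hC, hCD.symm, hDc, hCc, hDP, hCP, hyD, hxC⟩
    · exact (hdj hxC hyD).elim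
  obtain ⟨C', D', hCC, hDD, hCc', hDc', hCD', hun⟩ :=
    (hU _ (huU 2)).exists_bipartition hCc hDc hC hD hCD
  have hdj := Set.disjoint_left.1 hCD'
  have hmem : ∀ x, (x ∈ C' ∨ x ∈ D') ↔ x ∈ U ∧ x ≠ u 2 := fun x => by
    rw [← Set.mem_union, hun]
    rfl
  obtain ⟨a, ha, b, hb, hbC, hab⟩ := (hU _ (huU 2)).exists_adj (B := C')
    (hun ▸ Set.subset_union_left) hCc'.1 (x := u 1) (hun ▸ Or.inr (hDD h1))
    (fun h => hdj h (hDD h1))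
  have hbD : b ∈ D' := by have := (hmem b).2 hb; tauto
  have hcC := hCC hc
  have hdD := hDD hd
  refine ⟨![C', D', {u 2}], ?_, ?_, ?_, ?_, ?_, ?_⟩
  · simp [Fin.forall_fin_succ, hCC h0, hDD h1]
  · simp [Fin.forall_fin_succ, hCc', hDc', connSet_singleton]
  · have := huU 2
    simp only [Fin.forall_fin_succ]
    simp
    grind
  · intro x hx
    simp only [Fin.exists_fin_succ]
    simp
    have := hmem x
    grind
  · intro i j x
    have := hmem x
    have := @hdj x
    fin_cases i <;> fin_cases j <;> simp <;> grind
  · have e1 : ∃ a ∈ C', ∃ b ∈ D', G.Adj a b := ⟨a, ha, b, hbD, hab⟩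
    have e2 : ∃ a ∈ D', ∃ b ∈ C', G.Adj a b := ⟨b, hbD, a, ha, hab.symm⟩
    have e3 : ∃ a ∈ C', G.Adj a (u 2) := ⟨c, hcC, huc.symm⟩
    have e4 : ∃ a ∈ C', G.Adj (u 2) a := ⟨c, hcC, huc⟩
    have e5 : ∃ a ∈ D', G.Adj a (u 2) := ⟨d, hdD, hud.symm⟩
    have e6 : ∃ a ∈ D', G.Adj (u 2) a := ⟨d, hdD, hud⟩
    intro i j
    fin_cases i <;> fin_cases j <;> simp [e1, e2, e3, e4, e5, e6]

end SimpleGraph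

/-! ### Bipartitions that yield the constraint `K₄` -/

namespace ConstraintGraph

universe u

variable {V : Type u} {C : ConstraintGraph V} {U W : Set V}

/-- A bipartition of the vertex set into two sides spanned by connected parts of the constraint,
such that no edge of the constraint crosses it. -/
structure IsBipartition (C : ConstraintGraph V) (U W : Set V) : Prop where
  mem_right : ∀ v, v ∈ W ↔ v ∉ U
  connSet_left : C.constraintGraph.ConnSet U
  connSet_right : C.constraintGraph.ConnSet W
  not_adj : ∀ a ∈ U, ∀ b ∈ W, ¬ C.constraintGraph.Adj a b

theorem IsBipartition.symm (h : C.IsBipartition U W) : C.IsBipartition W U :=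
  ⟨fun v => by rw [h.mem_right, not_not], h.3, h.2, fun a ha b hb hab => h.4 b hb a ha hab.symm⟩

/-- The constraint is connected on each side, so it joins `A` to `B` and `D` to `E`, while none of
its edges crosses. These are the two disjoint constraint edges. -/
theorem IsBipartition.constraintK4_of_parts [Finite V] (h : C.IsBipartition U W)
    {A B D E : Set V} (hA : C.graph.ConnSet A) (hB : C.graph.ConnSet B) (hD : C.graph.ConnSet D)
    (hE : C.graph.ConnSet E) (hAB : Disjoint A B) (hU : A ∪ B = U) (hDE : Disjoint D E)
    (hW : D ∪ E = W) (hAD : ∃ a ∈ A, ∃ b ∈ D, C.graph.Adj a b)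
    (hAE : ∃ a ∈ A, ∃ b ∈ E, C.graph.Adj a b) (hBD : ∃ a ∈ B, ∃ b ∈ D, C.graph.Adj a b)
    (hBE : ∃ a ∈ B, ∃ b ∈ E, C.graph.Adj a b) : constraintK4.IsConstraintMinorOf C := by
  have hAB' := Set.disjoint_left.1 hAB
  have hDE' := Set.disjoint_left.1 hDE
  have hUm : ∀ v, v ∈ U ↔ v ∈ A ∨ v ∈ B := fun v => by rw [← hU]; rfl
  have hWm : ∀ v, v ∈ W ↔ v ∈ D ∨ v ∈ E := fun v => by rw [← hW]; rfl
  have hWU := h.mem_right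
  have cross : ∀ X Y : Set V, Disjoint X Y → C.constraintGraph.ConnSet (X ∪ Y) → X.Nonempty →
      Y.Nonempty → ∃ a ∈ X, ∃ b ∈ Y, C.constraintGraph.Adj a b := by
    intro X Y hXY hc hX ⟨y, hy⟩
    obtain ⟨a, ha, b, hb, hbX, hab⟩ := hc.exists_adj Set.subset_union_left hX (Or.inr hy)
      (fun h => Set.disjoint_left.1 hXY h hy)
    exact ⟨a, ha, b, hb.resolve_left hbX, hab⟩
  have symm : ∀ {G : SimpleGraph V} {X Y : Set V}, (∃ a ∈ X, ∃ b ∈ Y, G.Adj a b) →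
      ∃ a ∈ Y, ∃ b ∈ X, G.Adj a b := fun ⟨a, ha, b, hb, hab⟩ => ⟨b, hb, a, ha, hab.symm⟩
  have XAB := cross A B hAB (hU ▸ h.connSet_left) hA.1 hB.1
  have XDE := cross D E hDE (hW ▸ h.connSet_right) hD.1 hE.1
  have up : ∀ {X Y : Set V}, (∃ a ∈ X, ∃ b ∈ Y, C.constraintGraph.Adj a b) →
      ∃ a ∈ X, ∃ b ∈ Y, C.graph.Adj a b :=
    fun ⟨a, ha, b, hb, hab⟩ => ⟨a, ha, b, hb, C.constraintGraph_le hab⟩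
  refine isConstraintMinorOf_of_family ![A, B, D, E] ?_ ?_ ?_ ?_ ?_ ?_
  · intro v
    simp only [Fin.exists_fin_succ]
    simp
    grind
  · intro i j v
    have := @hAB' v
    have := @hDE' v
    have := hUm v
    have := hWm v
    have := hWU v
    fin_cases i <;> fin_cases j <;> simp <;> grind
  · simp [Fin.forall_fin_succ, hA, hB, hD, hE]
  · intro i j hij
    have hij := hij.ne
    fin_cases i <;> fin_cases j <;> first | exact absurd rfl hij | skip
    · exact up XAB
    · exact hAD
    · exact hAE
    · exact symm (up XAB)
    · exact hBD
    · exact hBE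
    · exact symm hAD
    · exact symm hBD
    · exact up XDE
    · exact symm hAE
    · exact symm hBE
    · exact symm (up XDE)
  · intro i j hij
    fin_cases i <;> fin_cases j <;>
      simp [constraintGraph, constraintK4] at hij
    · exact XAB
    · exact symm XAB
    · exact XDE
    · exact symm XDE
  · intro i j a ha b hb hab
    have h1 := h.not_adj a
    have h2 := h.not_adj b
    have h3 := hab.symm
    have h4 := hUm a
    have h5 := hUm b
    have h6 := hWm a
    have h7 := hWm b
    fin_cases i <;> fin_cases j <;> simp [constraintGraph, constraintK4] at ha hb ⊢ <;> grind

/-- A partition of one side extends to a constraint `K₄` if its parts are suitably linked on the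
other side. -/
theorem IsBipartition.constraintK4_of_linked [Finite V] (h : C.IsBipartition U W) {A B : Set V}
    (hA : C.graph.ConnSet A) (hB : C.graph.ConnSet B) (hAB : Disjoint A B) (hU : A ∪ B = U)
    (hL : C.graph.Linked W {w | w ∈ W ∧ ∃ a ∈ A, C.graph.Adj a w}
      {w | w ∈ W ∧ ∃ b ∈ B, C.graph.Adj b w}) : constraintK4.IsConstraintMinorOf C := by
  obtain ⟨D, E, hDW, hEW, hDE, hD, hE, ⟨x1, hx1, -, y1, hy1, hxy1⟩, ⟨x2, hx2, -, y2, hy2, hxy2⟩,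
    ⟨x3, hx3, -, y3, hy3, hxy3⟩, ⟨x4, hx4, -, y4, hy4, hxy4⟩⟩ := hL
  obtain ⟨D', E', hDD, hEE, hD', hE', hDE', hW⟩ :=
    (h.connSet_right.mono C.constraintGraph_le).exists_bipartition hD hE hDW hEW hDE
  exact h.constraintK4_of_parts hA hB hD' hE' hAB hU hDE' hW ⟨y1, hy1, x1, hDD hx1, hxy1⟩
    ⟨y3, hy3, x3, hEE hx3, hxy3⟩ ⟨y2, hy2, x2, hDD hx2, hxy2⟩ ⟨y4, hy4, x4, hEE hx4, hxy4⟩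

/-- Menger in `W` for the parts `{u}` and `U \ {u}`. If `s` separated their neighbourhoods, one of
`x, y` would survive in the separated part, whose only outer neighbours are `s` and `u`. -/
theorem IsBipartition.constraintK4_of_two_adj [Finite V] (h : C.IsBipartition U W)
    (hC : C.graph.TriConn) {u x y : V} (hu : u ∈ U) (hconn : C.graph.ConnSet (U \ {u}))
    (hx : x ∈ W) (hy : y ∈ W) (hxy : x ≠ y) (hux : C.graph.Adj u x) (huy : C.graph.Adj u y) :
    constraintK4.IsConstraintMinorOf C := by
  have hWU := h.mem_right
  refine h.constraintK4_of_linked (A := {u}) (B := U \ {u}) (C.graph.connSet_singleton u) hconn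
    (by grind) (by grind) ?_
  refine SimpleGraph.linked_of_not_separatedBy (by grind) (by grind) ⟨x, hx, u, rfl, hux⟩ ?_
  rintro s ⟨A, hA, hsA, hcl, hP, hQ⟩
  obtain ⟨z, hzs, hzA⟩ : ∃ z, z ≠ s ∧ z ∈ A := by
    have h1 := hP x ⟨hx, u, rfl, hux⟩
    have h2 := hP y ⟨hy, u, rfl, huy⟩
    grind
  obtain ⟨v, hv, hvu⟩ := hconn.1
  have key : ∀ a ∈ A, ∀ b, C.graph.Adj a b → b ∈ A ∨ b = s ∨ b = u := by
    intro a ha b hab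
    by_cases hb : b ∈ W
    · have := hcl a ha b hb hab
      tauto
    · have := hQ a
      have := hab.symm
      have := hA ha
      have := hWU b
      grind
  -- `s` need not lie in `W`; if it is the vertex `v` of `U`, then `u` alone bounds `A`.
  by_cases hvs : v = s
  · refine hC.false_of_cut (A := A) u u hzA (v := v) ?_ hvu hvu ?_
    · have := hWU v
      grind
    · intro a ha b hab
      have := key a ha b hab
      have := hQ a
      have := hab.symm
      have := hA ha
      grind
  · refine hC.false_of_cut (A := A) s u hzA (v := v) ?_ hvs hvu key
    have := hWU v
    grind

/-- The parts are a component `A` of `U \ {c}` and the rest of `U`, which is connected through `c`.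
If `s` separated their neighbourhoods in `W`, then `A` and the part of `W` cut off with it would
have only `s` and `c` as outer neighbours. -/
theorem IsBipartition.constraintK4_of_cutvertex [Finite V] (h : C.IsBipartition U W)
    (hC : C.graph.TriConn) {c : V} (hc : c ∈ U) (hU : U.Nontrivial)
    (hconn : ¬ C.graph.ConnSet (U \ {c})) : constraintK4.IsConstraintMinorOf C := by
  have hWU := h.mem_right
  have hUc := h.connSet_left.mono C.constraintGraph_le
  obtain ⟨x, hx, hxc⟩ := hU.exists_ne c
  obtain ⟨A, hAU, hxA, hA, hAcl⟩ := C.graph.exists_component (W := U \ {c}) (x := x) ⟨hx, hxc⟩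
  obtain ⟨y, hyU, hyc, hyA⟩ : ∃ y ∈ U, y ≠ c ∧ y ∉ A := by
    by_contra! hcon
    refine hconn ?_
    rwa [show U \ {c} = A from Set.Subset.antisymm (fun z hz => hcon z hz.1 hz.2) hAU]
  have hB : C.graph.ConnSet (U \ A) := by
    refine ⟨⟨y, hyU, hyA⟩, fun B hBs ⟨b, hb⟩ hcl => ?_⟩
    have key : ∀ X ⊆ U \ A, X.Nonempty → c ∉ X →
        (∀ b ∈ X, ∀ a ∈ U \ A, C.graph.Adj b a → a ∈ X) → False := by
      intro X hX hne hcX hXcl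
      obtain ⟨b, hb, a, ha, hab, hadj⟩ := hUc.exists_adj (B := X) (by grind) hne hc hcX
      have h1 := hXcl b hb a
      have h2 := hAcl a
      have h3 := hadj.symm
      grind
    by_contra hcon
    obtain ⟨z, hz, hzB⟩ := Set.not_subset.1 hcon
    by_cases hcB : c ∈ B
    · refine key ((U \ A) \ B) Set.sdiff_subset ⟨z, hz, hzB⟩ (by grind) ?_
      intro b hb a ha hba
      have := hcl a
      have := hba.symm
      grind
    · exact key B hBs ⟨b, hb⟩ hcB hcl
  refine h.constraintK4_of_linked hA hB (by grind) (by grind) ?_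
  have hP : {w | w ∈ W ∧ ∃ a ∈ A, C.graph.Adj a w}.Nonempty := by
    by_contra hcon
    refine hC.false_of_cut (A := A) c c hxA (v := y) hyA hyc hyc ?_
    intro a ha b hab
    by_cases hb : b ∈ W
    · exact (hcon ⟨b, hb, a, ha, hab⟩).elim
    · have := hAcl a ha b
      have := hWU b
      grind
  refine SimpleGraph.linked_of_not_separatedBy (by grind) (by grind) hP ?_
  rintro s ⟨A', hA', hsA', hcl, hP, hQ⟩
  -- A separator `s` in `U` removes nothing from `W`; in that case `c` takes its place.
  have key : ∀ s', (s' = s ∨ s ∈ U) → y ≠ s' → s' ∉ A → False := by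
    intro s' hs' hys hsA
    refine hC.false_of_cut (A := A ∪ A') s' c (x := x) (v := y) (Or.inl hxA) ?_ hys hyc ?_
    · have := hWU y
      grind
    · rintro a (ha | ha) b hab
      · by_cases hb : b ∈ W
        · have := hP b ⟨hb, a, ha, hab⟩
          have := hWU b
          grind
        · have := hAcl a ha b
          have := hWU b
          grind
      · by_cases hb : b ∈ W
        · have := hcl a ha b hb hab
          have := hWU b
          grind
        · have := hQ a
          have := hab.symm
          have := hA' ha
          have := hWU b
          grind
  by_cases hs : s ∈ U
  · exact key c (Or.inr hs) hyc (fun h => (hAU h).2 rfl)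
  · exact key s (Or.inl rfl) (fun h => hs (h ▸ hyU)) (fun h => hs (hAU h).1)

/-! ### Prisms -/

/-- Two connected triples of pairwise adjacent branch sets, joined by a matching. -/
structure IsPrismModel (C : ConstraintGraph V) (A B : Fin 3 → Set V) : Prop where
  connSet_left : ∀ i, C.graph.ConnSet (A i)
  connSet_right : ∀ i, C.graph.ConnSet (B i)
  cover : ∀ v, (∃ i, v ∈ A i) ∨ ∃ i, v ∈ B i
  disjoint_left : ∀ i j v, v ∈ A i → v ∈ A j → i = j
  disjoint_right : ∀ i j v, v ∈ B i → v ∈ B j → i = j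
  disjoint : ∀ i j v, v ∈ A i → v ∉ B j
  adj_left : ∀ i j, i ≠ j → ∃ a ∈ A i, ∃ b ∈ A j, C.graph.Adj a b
  adj_right : ∀ i j, i ≠ j → ∃ a ∈ B i, ∃ b ∈ B j, C.graph.Adj a b
  matching : ∀ i, ∃ a ∈ A i, ∃ b ∈ B i, C.graph.Adj a b
  not_adj : ∀ i j, ∀ a ∈ A i, ∀ b ∈ B j, ¬ C.constraintGraph.Adj a b
  constraint_left : ∀ i, ∃ j ≠ i, ∃ a ∈ A i, ∃ b ∈ A j, C.constraintGraph.Adj a b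
  constraint_right : ∀ i, ∃ j ≠ i, ∃ a ∈ B i, ∃ b ∈ B j, C.constraintGraph.Adj a b

theorem exists_adj_symm {G : SimpleGraph V} {X Y : Set V} (h : ∃ a ∈ X, ∃ b ∈ Y, G.Adj a b) :
    ∃ a ∈ Y, ∃ b ∈ X, G.Adj a b := by
  obtain ⟨a, ha, b, hb, hab⟩ := h
  exact ⟨b, hb, a, ha, hab.symm⟩

theorem IsPrismModel.symm {A B : Fin 3 → Set V} (h : C.IsPrismModel A B) :
    C.IsPrismModel B A where
  connSet_left := h.connSet_right
  connSet_right := h.connSet_left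
  cover v := (h.cover v).symm
  disjoint_left := h.disjoint_right
  disjoint_right := h.disjoint_left
  disjoint i j v hB hA := h.disjoint j i v hA hB
  adj_left := h.adj_right
  adj_right := h.adj_left
  matching i := exists_adj_symm (h.matching i)
  not_adj i j a ha b hb hab := h.not_adj j i b hb a ha hab.symm
  constraint_left := h.constraint_right
  constraint_right := h.constraint_left

theorem IsPrismModel.comp {A B : Fin 3 → Set V} (h : C.IsPrismModel A B)
    (σ : Equiv.Perm (Fin 3)) : C.IsPrismModel (A ∘ σ) (B ∘ σ) where
  connSet_left i := h.connSet_left _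
  connSet_right i := h.connSet_right _
  cover v := by
    rcases h.cover v with ⟨i, hi⟩ | ⟨i, hi⟩
    · exact Or.inl ⟨σ.symm i, by simpa using hi⟩
    · exact Or.inr ⟨σ.symm i, by simpa using hi⟩
  disjoint_left i j v hi hj := σ.injective (h.disjoint_left _ _ v hi hj)
  disjoint_right i j v hi hj := σ.injective (h.disjoint_right _ _ v hi hj)
  disjoint i j v := h.disjoint _ _ v
  adj_left i j hij := h.adj_left _ _ (σ.injective.ne hij)
  adj_right i j hij := h.adj_right _ _ (σ.injective.ne hij)
  matching i := h.matching _
  not_adj i j := h.not_adj _ _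
  constraint_left i := by
    obtain ⟨j, hj, hji⟩ := h.constraint_left (σ i)
    exact ⟨σ.symm j, fun h => hj (by simp [← h]), by simpa using hji⟩
  constraint_right i := by
    obtain ⟨j, hj, hji⟩ := h.constraint_right (σ i)
    exact ⟨σ.symm j, fun h => hj (by simp [← h]), by simpa using hji⟩

theorem IsPrismModel.isConstraintMinorOf [Finite V] {A B : Fin 3 → Set V}
    (h : C.IsPrismModel A B) {D : ConstraintGraph (Fin 6)} (hD : D.graph = prismGraph)
    (hX : ∀ i j, i ≠ j → (D.constraintGraph.Adj i j ↔
      ∃ a ∈ ![A 0, A 1, A 2, B 0, B 1, B 2] i, ∃ b ∈ ![A 0, A 1, A 2, B 0, B 1, B 2] j,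
        C.constraintGraph.Adj a b)) : D.IsConstraintMinorOf C := by
  refine isConstraintMinorOf_of_family ![A 0, A 1, A 2, B 0, B 1, B 2] ?_ ?_ ?_ ?_ ?_ ?_
  · intro v
    have := h.cover v
    simp only [Fin.exists_fin_succ] at this ⊢
    simp at this ⊢
    tauto
  · intro i j v
    have h1 := h.disjoint_left
    have h2 := h.disjoint_right
    have h3 := h.disjoint
    fin_cases i <;> fin_cases j <;> simp <;> grind
  · simp [Fin.forall_fin_succ, h.connSet_left, h.connSet_right]
  · intro i j hij
    rw [hD] at hij
    fin_cases i <;> fin_cases j <;>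
      first
      | exact h.adj_left _ _ (by decide)
      | exact h.adj_right _ _ (by decide)
      | exact h.matching _
      | exact exists_adj_symm (h.matching _)
      | (exfalso; simp [prismGraph] at hij)
  · intro i j hij
    exact (hX i j hij.ne).1 hij
  · intro i j a ha b hb hab
    by_cases hij : i = j
    · exact Or.inl hij
    · exact Or.inr ((hX i j hij).2 ⟨a, ha, b, hb, hab⟩)

end ConstraintGraph

/-! ### From prism models to the four constraint prisms -/

namespace ConstraintGraph

universe u

variable {V : Type u} {C : ConstraintGraph V} {U W : Set V}

/-- One of the six obstructions is a constraint minor. -/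
def HasObstruction (C : ConstraintGraph V) : Prop :=
  constraintK4.IsConstraintMinorOf C ∨ constraintWheel.IsConstraintMinorOf C ∨
    constraintPrism₁.IsConstraintMinorOf C ∨ constraintPrism₂.IsConstraintMinorOf C ∨
    constraintPrism₃.IsConstraintMinorOf C ∨ constraintPrism₄.IsConstraintMinorOf C

/-- The constraint has an edge between the sets `X` and `Y`. -/
def Touch (C : ConstraintGraph V) (X Y : Set V) : Prop :=
  ∃ a ∈ X, ∃ b ∈ Y, C.constraintGraph.Adj a b

theorem Touch.symm {X Y : Set V} (h : C.Touch X Y) : C.Touch Y X := exists_adj_symm h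

theorem touch_comm {X Y : Set V} : C.Touch X Y ↔ C.Touch Y X := ⟨Touch.symm, Touch.symm⟩

theorem IsPrismModel.isConstraintMinorOf_of_touch [Finite V] {A B : Fin 3 → Set V}
    (h : C.IsPrismModel A B) {D : ConstraintGraph (Fin 6)} (hD : D.graph = prismGraph)
    (h01 : D.constraintGraph.Adj 0 1 ↔ C.Touch (A 0) (A 1))
    (h12 : D.constraintGraph.Adj 1 2 ↔ C.Touch (A 1) (A 2))
    (h02 : D.constraintGraph.Adj 0 2 ↔ C.Touch (A 0) (A 2))
    (h34 : D.constraintGraph.Adj 3 4 ↔ C.Touch (B 0) (B 1))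
    (h45 : D.constraintGraph.Adj 4 5 ↔ C.Touch (B 1) (B 2))
    (h35 : D.constraintGraph.Adj 3 5 ↔ C.Touch (B 0) (B 2))
    (hn : ∀ i j : Fin 3, ¬ D.constraintGraph.Adj (Fin.castLE (by decide) i) (Fin.natAdd 3 j)) :
    D.IsConstraintMinorOf C := by
  have hn' : ∀ i j : Fin 3, D.constraintGraph.Adj (Fin.castLE (by decide) i) (Fin.natAdd 3 j) ↔
      C.Touch (A i) (B j) := fun i j =>
    iff_of_false (hn i j) fun ⟨a, ha, b, hb, hab⟩ => h.not_adj i j a ha b hb hab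
  have sw : ∀ {i j X Y}, (D.constraintGraph.Adj i j ↔ C.Touch X Y) →
      (D.constraintGraph.Adj j i ↔ C.Touch Y X) := by
    intro i j X Y h
    rw [SimpleGraph.adj_comm, touch_comm, h]
  refine h.isConstraintMinorOf hD fun i j hij => ?_
  change _ ↔ C.Touch _ _
  fin_cases i <;> fin_cases j <;>
    first
    | exact absurd rfl hij
    | exact h01
    | exact h12
    | exact h02
    | exact h34
    | exact h45
    | exact h35
    | exact sw h01
    | exact sw h12
    | exact sw h02
    | exact sw h34
    | exact sw h45
    | exact sw h35
    | exact hn' 0 0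
    | exact hn' 0 1
    | exact hn' 0 2
    | exact hn' 1 0
    | exact hn' 1 1
    | exact hn' 1 2
    | exact hn' 2 0
    | exact hn' 2 1
    | exact hn' 2 2
    | exact sw (hn' 0 0)
    | exact sw (hn' 0 1)
    | exact sw (hn' 0 2)
    | exact sw (hn' 1 0)
    | exact sw (hn' 1 1)
    | exact sw (hn' 1 2)
    | exact sw (hn' 2 0)
    | exact sw (hn' 2 1)
    | exact sw (hn' 2 2)

theorem touch_of_not_touch {A : Fin 3 → Set V}
    (h : ∀ i, ∃ j ≠ i, C.Touch (A i) (A j)) {i j k : Fin 3} (hij : i ≠ j) (hik : i ≠ k)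
    (hjk : j ≠ k) (hn : ¬ C.Touch (A i) (A j)) : C.Touch (A i) (A k) := by
  obtain ⟨l, hl, hil⟩ := h i
  obtain rfl | rfl : l = j ∨ l = k := by lia
  · exact (hn hil).elim
  · exact hil

/-- A missing constraint edge forces the other two of its triangle. On the other triangle the
missing pair is `02` (third prism), `12` or `01` (fourth, after swapping `0` and `2` in the latter
case), or none (second, with the triangles exchanged). -/
theorem IsPrismModel.hasObstruction_of_not_touch [Finite V] {A B : Fin 3 → Set V}
    (h : C.IsPrismModel A B) (hn : ¬ C.Touch (A 0) (A 2)) : C.HasObstruction := by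
  have key : ∀ A B, C.IsPrismModel A B → ¬ C.Touch (A 0) (A 2) →
      C.Touch (A 0) (A 1) ∧ C.Touch (A 1) (A 2) := fun A B h hn =>
    ⟨touch_of_not_touch h.constraint_left (by decide) (by decide) (by decide) hn,
      (touch_of_not_touch h.constraint_left (i := 2) (j := 0) (k := 1) (by decide) (by decide)
        (by decide) fun h' => hn h'.symm).symm⟩
  have case12 : ∀ A B, C.IsPrismModel A B → ¬ C.Touch (A 0) (A 2) → ¬ C.Touch (B 1) (B 2) →
      constraintPrism₄.IsConstraintMinorOf C := by
    intro A B h hn hB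
    obtain ⟨h01, h12⟩ := key A B h hn
    have h34 := (touch_of_not_touch h.constraint_right (i := 1) (j := 2) (k := 0) (by decide)
      (by decide) (by decide) hB).symm
    have h35 := (touch_of_not_touch h.constraint_right (i := 2) (j := 1) (k := 0) (by decide)
      (by decide) (by decide) fun h' => hB h'.symm).symm
    refine h.isConstraintMinorOf_of_touch rfl ?_ ?_ ?_ ?_ ?_ ?_ ?_ <;>
      simp [*, constraintGraph, constraintPrism₄, Fin.forall_fin_succ]
  obtain ⟨h01, h12⟩ := key A B h hn
  by_cases h35 : C.Touch (B 0) (B 2)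
  swap
  · obtain ⟨h34, h45⟩ := key B A h.symm h35
    refine Or.inr (Or.inr (Or.inr (Or.inr (Or.inl
      (h.isConstraintMinorOf_of_touch rfl ?_ ?_ ?_ ?_ ?_ ?_ ?_))))) <;>
      simp [*, constraintGraph, constraintPrism₃, Fin.forall_fin_succ]
  by_cases h45 : C.Touch (B 1) (B 2)
  swap
  · exact Or.inr (Or.inr (Or.inr (Or.inr (Or.inr (case12 A B h hn h45)))))
  by_cases h34 : C.Touch (B 0) (B 1)
  swap
  · refine Or.inr (Or.inr (Or.inr (Or.inr (Or.inr (case12 _ _ (h.comp (Equiv.swap 0 2)) ?_ ?_)))))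
    · exact fun h' => hn h'.symm
    · exact fun h' => h34 h'.symm
  refine Or.inr (Or.inr (Or.inr (Or.inl
      (h.symm.isConstraintMinorOf_of_touch rfl ?_ ?_ ?_ ?_ ?_ ?_ ?_)))) <;>
      simp [*, constraintGraph, constraintPrism₂, Fin.forall_fin_succ]

theorem IsPrismModel.hasObstruction [Finite V] {A B : Fin 3 → Set V} (h : C.IsPrismModel A B) :
    C.HasObstruction := by
  by_cases hA : ∃ i j, i ≠ j ∧ (¬ C.Touch (A i) (A j) ∨ ¬ C.Touch (B i) (B j))
  · obtain ⟨i, j, hij, hAB⟩ := hA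
    obtain ⟨σ, rfl, rfl⟩ : ∃ σ : Equiv.Perm (Fin 3), σ 0 = i ∧ σ 2 = j :=
      (by decide : ∀ i j : Fin 3, i ≠ j → ∃ σ : Equiv.Perm (Fin 3), σ 0 = i ∧ σ 2 = j) i j hij
    rcases hAB with hA | hB
    · exact (h.comp σ).hasObstruction_of_not_touch hA
    · exact (h.comp σ).symm.hasObstruction_of_not_touch hB
  · push Not at hA
    have h01 := hA 0 1 (by decide)
    have h12 := hA 1 2 (by decide)
    have h02 := hA 0 2 (by decide)
    refine Or.inr (Or.inr (Or.inl
      (h.isConstraintMinorOf_of_touch rfl ?_ ?_ ?_ ?_ ?_ ?_ ?_))) <;>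
      simp [*, constraintGraph, constraintPrism₁, Fin.forall_fin_succ]

/-- Without a constraint `K₄`, the edges across form a matching and neither side has a cutvertex;
three of these edges root a triangle of branch sets on each side. -/
theorem IsBipartition.hasObstruction [Finite V] (h : C.IsBipartition U W)
    (hC : C.graph.TriConn) (hU : U.Nontrivial) (hW : W.Nontrivial) : C.HasObstruction := by
  by_contra hno
  have hK : ¬ constraintK4.IsConstraintMinorOf C := fun h => hno (Or.inl h)
  have hUc : ∀ u ∈ U, C.graph.ConnSet (U \ {u}) := fun u hu =>
    by_contra fun hc => hK (h.constraintK4_of_cutvertex hC hu hU hc)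
  have hWc : ∀ u ∈ W, C.graph.ConnSet (W \ {u}) := fun u hu =>
    by_contra fun hc => hK (h.symm.constraintK4_of_cutvertex hC hu hW hc)
  have hU1 : ∀ u ∈ U, ∀ x ∈ W, ∀ y ∈ W, C.graph.Adj u x → C.graph.Adj u y → x = y :=
    fun u hu x hx y hy hux huy =>
      by_contra fun hxy => hK (h.constraintK4_of_two_adj hC hu (hUc u hu) hx hy hxy hux huy)
  have hW1 : ∀ u ∈ W, ∀ x ∈ U, ∀ y ∈ U, C.graph.Adj u x → C.graph.Adj u y → x = y :=
    fun u hu x hx y hy hux huy =>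
      by_contra fun hxy =>
        hK (h.symm.constraintK4_of_two_adj hC hu (hWc u hu) hx hy hxy hux huy)
  have hWU := h.mem_right
  -- If only `s` and `t` had neighbours across, 3-connectedness would leave no further vertex in
  -- `U`. Then `s` would have two neighbours in `W`, against `hU1`.
  have hex : ∀ s ∈ U, ∀ t ∈ U, ∃ u ∈ U, u ≠ s ∧ u ≠ t ∧ ∃ w ∈ W, C.graph.Adj u w := by
    intro s hs t ht
    by_contra! hcon
    obtain ⟨w, hw⟩ := hW.nonempty
    have hcl : ∀ a ∈ W, ∀ b, C.graph.Adj a b → b ∈ W ∨ b = s ∨ b = t := by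
      intro a ha b hab
      have := hcon b
      have := hab.symm
      have := hWU b
      grind
    have hst : ∀ v ∈ U, v = s ∨ v = t := by
      intro v hv
      have := hC.2 W s t ⟨w, hw⟩ hcl v
      have := hWU v
      tauto
    obtain ⟨x, hx1, hx2, -⟩ := hC.exists_adj_ne s t t
    obtain ⟨y, hy1, hy2, hy3⟩ := hC.exists_adj_ne s t x
    have hxW : x ∈ W := by
      have := hst x
      have := hx1.ne
      have := hWU x
      grind
    have hyW : y ∈ W := by
      have := hst y
      have := hy1.ne
      have := hWU y
      grind
    exact hy3 (hU1 s hs y hyW x hxW hy1 hx1)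
  obtain ⟨u₀, hu₀⟩ := hU.nonempty
  obtain ⟨a, haU, -, -, x, hx, hax⟩ := hex u₀ hu₀ u₀ hu₀
  obtain ⟨b, hbU, hba, -, y, hy, hby⟩ := hex a haU a haU
  obtain ⟨c, hcU, hca, hcb, z, hz, hcz⟩ := hex a haU b hbU
  have hxy : x ≠ y := fun hxy => hba (hW1 x hx b hbU a haU (hxy ▸ hby.symm) hax.symm)
  have hxz : x ≠ z := fun hxz => hca (hW1 x hx c hcU a haU (hxz ▸ hcz.symm) hax.symm)
  have hyz : y ≠ z := fun hyz => hcb (hW1 y hy c hcU b hbU (hyz ▸ hcz.symm) hby.symm)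
  have hinj : ∀ {p q r : V}, p ≠ q → p ≠ r → q ≠ r → Function.Injective ![p, q, r] := by
    intro p q r h1 h2 h3 i j
    have := h1.symm
    have := h2.symm
    have := h3.symm
    fin_cases i <;> fin_cases j <;> simp [*]
  obtain ⟨A, hA1, hA2, hA3, hA4, hA5, hA6⟩ := SimpleGraph.exists_rooted_triangle hUc ![a, b, c]
    (hinj hba.symm hca.symm hcb.symm) (fun i => by fin_cases i <;> assumption)
  obtain ⟨B, hB1, hB2, hB3, hB4, hB5, hB6⟩ := SimpleGraph.exists_rooted_triangle hWc ![x, y, z]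
    (hinj hxy hxz hyz) (fun i => by fin_cases i <;> assumption)
  have touch : ∀ (X : Set V) (F : Fin 3 → Set V), C.constraintGraph.ConnSet X →
      (∀ i, (F i).Nonempty) → (∀ i, F i ⊆ X) → (∀ x ∈ X, ∃ i, x ∈ F i) →
      (∀ i j x, x ∈ F i → x ∈ F j → i = j) →
      ∀ i, ∃ j ≠ i, ∃ a ∈ F i, ∃ b ∈ F j, C.constraintGraph.Adj a b := by
    intro X F hX hne hFX hcov hdisj i
    obtain ⟨j, hj⟩ : ∃ j, j ≠ i := exists_ne i
    obtain ⟨p, hp⟩ := hne j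
    obtain ⟨a, ha, b, hb, hbi, hab⟩ := hX.exists_adj (hFX i) (hne i) (hFX j hp)
      fun h => hj (hdisj _ _ _ hp h)
    obtain ⟨k, hk⟩ := hcov b hb
    exact ⟨k, fun h => hbi (h ▸ hk), a, ha, b, hk, hab⟩
  refine hno (IsPrismModel.hasObstruction (A := A) (B := B)
    ⟨hA2, hB2, fun v => ?_, hA5, hB5, ?_, hA6, hB6, fun i => ?_, ?_,
    touch U A h.connSet_left (fun i => (hA2 i).1) hA3 hA4 hA5,
    touch W B h.connSet_right (fun i => (hB2 i).1) hB3 hB4 hB5⟩)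
  · by_cases hv : v ∈ U
    · exact Or.inl (hA4 v hv)
    · exact Or.inr (hB4 v ((hWU v).2 hv))
  · exact fun i j v hi hj => (hWU v).1 (hB3 j hj) (hA3 i hi)
  · fin_cases i
    · exact ⟨a, hA1 0, x, hB1 0, hax⟩
    · exact ⟨b, hA1 1, y, hB1 1, hby⟩
    · exact ⟨c, hA1 2, z, hB1 2, hcz⟩
  · exact fun i j a ha b hb => h.not_adj a (hA3 i ha) b (hB3 j hb)

end ConstraintGraph

/-! ### Irreducible constraint graphs and the induction -/

namespace ConstraintGraph

universe u

variable {V : Type u} {C : ConstraintGraph V}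

theorem exists_ne_of_five [Finite V] {a b c d e : V} (h : [a, b, c, d, e].Nodup) (p q r s : V) :
    ∃ x, x ≠ p ∧ x ≠ q ∧ x ≠ r ∧ x ≠ s := by
  classical
  have h1 : ({p, q, r, s} : Finset V).card < [a, b, c, d, e].toFinset.card := by
    rw [List.toFinset_card_of_nodup h]
    exact lt_of_le_of_lt Finset.card_le_four (by simp)
  obtain ⟨x, -, hx⟩ := Finset.exists_mem_notMem_of_card_lt_card h1
  exact ⟨x, by simpa using hx⟩

theorem HasObstruction.of_contractEdge {e : Sym2 V} (he : e ∈ C.graph.edgeSet)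
    (h : (C.contractEdge e).HasObstruction) : C.HasObstruction :=
  h.imp (.contract C e he) <| Or.imp (.contract C e he) <| Or.imp (.contract C e he) <|
    Or.imp (.contract C e he) <| Or.imp (.contract C e he) (.contract C e he)

theorem HasObstruction.of_deleteEdge {e : Sym2 V} (he : e ∈ C.graph.edgeSet)
    (heX : e ∉ C.constraint) (h : (C.deleteEdge e heX).HasObstruction) : C.HasObstruction :=
  h.imp (.delete C e he heX) <| Or.imp (.delete C e he heX) <| Or.imp (.delete C e he heX) <|
    Or.imp (.delete C e he heX) <| Or.imp (.delete C e he heX) (.delete C e he heX)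

/-- A constraint cut survives the contraction of an edge that does not cross it, if both sides
keep an edge of the constraint. -/
theorem exists_isConstraintCut_contractEdge {u v : V} {S : Set V}
    (hS : ∀ a ∈ S, ∀ b, C.constraintGraph.Adj a b → b ∈ S) (huv : u ∈ S ↔ v ∈ S)
    (hin : ∃ a ∈ S, ∃ b, C.constraintGraph.Adj a b ∧ s(a, b) ≠ s(u, v))
    (hout : ∃ a ∉ S, ∃ b, C.constraintGraph.Adj a b ∧ s(a, b) ≠ s(u, v)) :
    ∃ T, (C.contractEdge s(u, v)).IsConstraintCut T := by
  have hmem : ∀ x, (Quot.mk _ x : ContractVert s(u, v)) ∈ (Quot.mk _ '' S : Set _) ↔ x ∈ S := by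
    intro x
    refine ⟨?_, fun h => ⟨x, h, rfl⟩⟩
    rintro ⟨y, hy, hyx⟩
    rcases SimpleGraph.contractVert_mk_eq_iff.1 hyx with rfl | h
    · exact hy
    · rcases Sym2.eq_iff.1 h with ⟨rfl, rfl⟩ | ⟨rfl, rfl⟩ <;> tauto
  obtain ⟨a, ha, b, hab, hne⟩ := hin
  obtain ⟨c, hc, d, hcd, hne'⟩ := hout
  refine ⟨Quot.mk _ '' S, fun p hp q hpq => ?_,
    ⟨_, (hmem a).2 ha, _, mem_contractEdge_constraint hab hne⟩,
    ⟨_, fun h => hc ((hmem c).1 h), _, mem_contractEdge_constraint hcd hne'⟩⟩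
  obtain ⟨x, y, hxy, rfl, rfl⟩ := exists_of_mem_contractEdge_constraint hpq
  rw [hmem] at hp ⊢
  exact hS x hp y hxy

/-- A connected part of the constraint, closed under adjacency, with at least one edge. -/
structure IsComponent (C : ConstraintGraph V) (K : Set V) : Prop where
  connSet : C.constraintGraph.ConnSet K
  closed : ∀ a ∈ K, ∀ b, C.constraintGraph.Adj a b → b ∈ K
  exists_adj : ∃ a ∈ K, ∃ b ∈ K, C.constraintGraph.Adj a b

theorem exists_isComponent {a b : V} (h : C.constraintGraph.Adj a b) :
    ∃ K, C.IsComponent K ∧ a ∈ K := by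
  obtain ⟨K, -, ha, hK, hcl⟩ := C.constraintGraph.exists_component (Set.mem_univ a)
  exact ⟨K, ⟨hK, fun a ha b hab => hcl a ha b trivial hab, a, ha, b, hcl a ha b trivial h, h⟩, ha⟩

theorem IsComponent.subset_of_mem {K S : Set V} (hK : C.IsComponent K)
    (hS : ∀ a ∈ S, ∀ b, C.constraintGraph.Adj a b → b ∈ S) {x : V} (hxK : x ∈ K) (hxS : x ∈ S) :
    K ⊆ S := fun _ hy =>
  (hK.connSet.2 (K ∩ S) Set.inter_subset_left ⟨x, hxK, hxS⟩
    (fun b hb a ha hab => ⟨ha, hS b hb.2 a hab⟩) hy).2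

theorem IsComponent.exists_constraint_adj {K : Set V} (hK : C.IsComponent K) {x : V}
    (hx : x ∈ K) : ∃ y ∈ K, C.constraintGraph.Adj x y := by
  obtain ⟨a, ha, b, hb, hab⟩ := hK.exists_adj
  by_cases hxa : a = x
  · exact ⟨b, hb, hxa ▸ hab⟩
  · obtain ⟨_, rfl, z, hz, -, hyz⟩ := hK.connSet.exists_adj (B := {x}) (by simpa using hx) ⟨x, rfl⟩
      ha hxa
    exact ⟨z, hz, hyz⟩

/-- The wheel that remains if no further reduction is possible. -/
theorem constraintWheel_isConstraintMinorOf [Finite V] {a b x y z : V}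
    (hcov : ∀ v, v = b ∨ v = a ∨ v = x ∨ v = y ∨ v = z) (hnd : [b, a, x, y, z].Nodup)
    (hab : C.constraintGraph.Adj a b) (hxy : C.constraintGraph.Adj x y)
    (hX : ∀ p q, C.constraintGraph.Adj p q → s(p, q) = s(a, b) ∨ s(p, q) = s(x, y))
    (hax : C.graph.Adj a x) (hby : C.graph.Adj b y) (hza : C.graph.Adj z a)
    (hzb : C.graph.Adj z b) (hzx : C.graph.Adj z x) (hzy : C.graph.Adj z y) :
    constraintWheel.IsConstraintMinorOf C := by
  have hab' := C.constraintGraph_le hab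
  have hxy' := C.constraintGraph_le hxy
  simp only [List.nodup_cons, List.mem_cons, List.not_mem_nil, or_false, not_or] at hnd
  refine isConstraintMinorOf_of_family ![{b}, {a}, {x}, {y}, {z}] ?_ ?_ ?_ ?_ ?_ ?_
  · intro v
    simpa [Fin.exists_fin_succ] using hcov v
  · intro i j v
    fin_cases i <;> fin_cases j <;> simp <;> grind
  · simp [Fin.forall_fin_succ, SimpleGraph.connSet_singleton]
  · intro i j hij
    have := hab'.symm
    have := hxy'.symm
    have := hax.symm
    have := hby.symm
    have := hza.symm
    have := hzb.symm
    have := hzx.symm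
    have := hzy.symm
    fin_cases i <;> fin_cases j <;>
      first
      | (exfalso; simp [constraintWheel, wheelGraph] at hij; done)
      | exact ⟨_, rfl, _, rfl, by assumption⟩
  · intro i j hij
    have := hab.symm
    have := hxy.symm
    fin_cases i <;> fin_cases j <;>
      first
      | (exfalso; simp [constraintWheel, constraintGraph] at hij; done)
      | exact ⟨_, rfl, _, rfl, by assumption⟩
  · intro i j p hp q hq hpq
    have := hX p q hpq
    simp only [Sym2.eq_iff] at this
    fin_cases i <;> fin_cases j <;> simp [constraintWheel, constraintGraph] at hp hq ⊢ <;> grind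

/-- A 3-connected constraint graph with at least two components of the constraint, none of whose
single deletions and contractions can be used for an induction. -/
structure IsIrreducible (C : ConstraintGraph V) : Prop where
  triConn : C.graph.TriConn
  deletion : ∀ u v, C.graph.Adj u v → ¬ C.constraintGraph.Adj u v →
    ¬ (C.graph.deleteEdges {s(u, v)}).TriConn
  -- `S` is a side of the cut that the contraction leaves intact; on the other side a constraint
  -- edge besides `uv` would have to survive.
  contraction : ∀ u v, C.graph.Adj u v → (C.graph.contract s(u, v)).TriConn →
    ∀ S : Set V, (∀ a ∈ S, ∀ b, C.constraintGraph.Adj a b → b ∈ S) → u ∉ S → v ∉ S →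
    (∃ a ∈ S, ∃ b ∈ S, C.constraintGraph.Adj a b) →
    ¬ ∃ a ∉ S, ∃ b, C.constraintGraph.Adj a b ∧ s(a, b) ≠ s(u, v)

/-- A contractible edge that misses one component leaves a cut: this component is kept, and so is an
edge of one of the other two. As no edge meets three disjoint sets, no edge is contractible, but
`exists_contract` at an edge leaving `K₁` provides one. -/
theorem IsIrreducible.false_of_three [Finite V] (hC : C.IsIrreducible) {K₁ K₂ K₃ : Set V}
    (h1 : C.IsComponent K₁) (h2 : C.IsComponent K₂) (h3 : C.IsComponent K₃)
    (h12 : ∀ x ∈ K₁, x ∉ K₂) (h13 : ∀ x ∈ K₁, x ∉ K₃) (h23 : ∀ x ∈ K₂, x ∉ K₃) : False := by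
  have aux : ∀ K K' K'', C.IsComponent K → C.IsComponent K' → C.IsComponent K'' →
      (∀ x ∈ K, x ∉ K') → (∀ x ∈ K, x ∉ K'') → (∀ x ∈ K', x ∉ K'') →
      ∀ u v, C.graph.Adj u v → (C.graph.contract s(u, v)).TriConn → u ∈ K ∨ v ∈ K := by
    intro K K' K'' hK hK' hK'' hd1 hd2 hd3 u v huv hcon
    by_contra! hn
    obtain ⟨a, ha, b, hb, hab⟩ := hK'.exists_adj
    obtain ⟨c, hc, d, hd, hcd⟩ := hK''.exists_adj
    refine hC.contraction u v huv hcon K hK.closed hn.1 hn.2 hK.exists_adj ?_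
    by_cases he : s(a, b) = s(u, v)
    · refine ⟨c, fun h => hd2 c h hc, d, hcd, fun he' => ?_⟩
      rw [← he, Sym2.eq_iff] at he'
      grind
    · exact ⟨a, fun h => hd1 a h ha, b, hab, he⟩
  have hcon : ∀ u v, C.graph.Adj u v → ¬ (C.graph.contract s(u, v)).TriConn := by
    intro u v huv h
    have := aux K₁ K₂ K₃ h1 h2 h3 h12 h13 h23 u v huv h
    have := aux K₂ K₁ K₃ h2 h1 h3 (by grind) h23 h13 u v huv h
    have := aux K₃ K₁ K₂ h3 h1 h2 (by grind) (by grind) h12 u v huv h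
    have := h12 u
    have := h12 v
    have := h13 u
    have := h13 v
    have := h23 u
    have := h23 v
    tauto
  obtain ⟨a₁, ha₁, b₁, hb₁, hab₁⟩ := h1.exists_adj
  obtain ⟨a₂, ha₂, b₂, hb₂, hab₂⟩ := h2.exists_adj
  obtain ⟨a₃, ha₃, b₃, hb₃, hab₃⟩ := h3.exists_adj
  have hnd : [a₁, b₁, a₂, b₂, a₃].Nodup := by
    have := hab₁.ne
    have := hab₂.ne
    simp only [List.nodup_cons, List.mem_cons, List.not_mem_nil, or_false, not_or,
      not_false_eq_true, List.nodup_nil, and_true]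
    grind
  obtain ⟨z, hz, v, -, hv, hzv⟩ := (hC.triConn.connSet_univ a₁).exists_adj (Set.subset_univ K₁)
    ⟨a₁, ha₁⟩ (Set.mem_univ a₂) fun h => h12 _ h ha₂
  obtain ⟨p, -, -, -, -, hvp, -, -, hp, -⟩ := hC.triConn.exists_contract (exists_ne_of_five hnd) hzv
    (hC.deletion z v hzv fun h => hv (h1.closed z hz v h)) fun p hp => hcon z p hp
  exact hcon v p hvp hp

/-- The neighbours of a vertex `z` outside all components. -/
theorem IsIrreducible.adj_structure (hC : C.IsIrreducible)
    (h5 : ∀ p q r s : V, ∃ x, x ≠ p ∧ x ≠ q ∧ x ≠ r ∧ x ≠ s) {K K' : Set V}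
    (hK : C.IsComponent K) (hK' : C.IsComponent K') (hd : ∀ x ∈ K, x ∉ K') {z : V} (hzK : z ∉ K)
    (hzK' : z ∉ K') (hz : ∀ x, ¬ C.constraintGraph.Adj z x) {v : V} (hzv : C.graph.Adj z v) :
    (v ∈ K ∨ v ∈ K') ∧ (∀ s t, ∃ x, C.graph.Adj z x ∧ x ≠ v ∧ x ≠ s ∧ x ≠ t) ∧
    (v ∈ K → ∃ p q, C.constraintGraph.Adj v p ∧ q ∈ K' ∧ C.graph.Adj v q ∧
      (∀ x ∈ K, x = v ∨ x = p) ∧ ∀ x, C.graph.Adj v x → x = z ∨ x = p ∨ x = q) := by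
  -- `w` lies in at most one component, so the edge misses the other; and the first keeps its
  -- constraint edges because `u` is not in it.
  have hout : ∀ u w, C.graph.Adj u w → u ∉ K → u ∉ K' →
      ¬ (C.graph.contract s(u, w)).TriConn := by
    intro u w huw hu hu' hcon
    have key : ∀ K K', C.IsComponent K → C.IsComponent K' → (∀ x ∈ K, x ∉ K') → u ∉ K →
        u ∉ K' → w ∉ K → False := by
      intro K K' hK hK' hd hu hu' hw
      obtain ⟨a, ha, b, hb, hab⟩ := hK'.exists_adj
      refine hC.contraction u w huw hcon K hK.closed hu hw hK.exists_adj
        ⟨a, fun h => hd a h ha, b, hab, fun he => ?_⟩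
      rw [Sym2.eq_iff] at he
      grind
    by_cases hw : w ∈ K
    · exact key K' K hK' hK (by grind) hu' hu (hd w hw)
    · exact key K K' hK hK' hd hu hu' hw
  obtain ⟨p, q, hpq, hpz, hqz, hvp, hvq, hN, hcp, hcq, hdeg⟩ := hC.triConn.exists_contract h5 hzv
    (hC.deletion z v hzv (hz v)) fun p hp => hout z p hp hzK hzK'
  refine ⟨?_, hdeg, fun hv => ?_⟩
  · by_contra! hv
    exact hout v p hvp hv.1 hv.2 hcp
  -- With `vp` in the constraint, a further vertex of `K` would provide a constraint edge that
  -- survives the contraction of `vp`. If `q` were not in `K'`, then `vp` would survive the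
  -- contraction of `vq`.
  have main : ∀ p q, p ≠ q → C.graph.Adj v q → (∀ x, C.graph.Adj v x → x = z ∨ x = p ∨ x = q) →
      (C.graph.contract s(v, p)).TriConn → (C.graph.contract s(v, q)).TriConn →
      C.constraintGraph.Adj v p → ∃ p q, C.constraintGraph.Adj v p ∧ q ∈ K' ∧ C.graph.Adj v q ∧
      (∀ x ∈ K, x = v ∨ x = p) ∧ ∀ x, C.graph.Adj v x → x = z ∨ x = p ∨ x = q := by
    intro p q hpq hvq hN hcp hcq hvp
    have hp := hK.closed v hv p hvp
    have hsub : ∀ x ∈ K, x = v ∨ x = p := by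
      intro x hx
      by_contra! hxvp
      obtain ⟨r, hr, t, ht, htr, hrt⟩ := hK.connSet.exists_adj (B := {v, p})
        (Set.insert_subset hv (Set.singleton_subset_iff.2 hp)) ⟨v, by simp⟩ hx (by simpa using hxvp)
      refine hC.contraction v p (C.constraintGraph_le hvp) hcp K' hK'.closed (hd v hv) (hd p hp)
        hK'.exists_adj ⟨r, by grind, t, hrt, fun he => ?_⟩
      rw [Sym2.eq_iff] at he
      grind
    refine ⟨p, q, hvp, ?_, hvq, hsub, hN⟩
    by_contra hq
    refine hC.contraction v q hvq hcq K' hK'.closed (hd v hv) hq hK'.exists_adj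
      ⟨v, hd v hv, p, hvp, fun he => ?_⟩
    rw [Sym2.eq_iff] at he
    have := hvp.ne
    grind
  obtain ⟨r, hr, hvr⟩ := hK.exists_constraint_adj hv
  rcases hN r (C.constraintGraph_le hvr) with rfl | rfl | rfl
  · exact (hzK hr).elim
  · exact main r q hpq hvq hN hcp hcq hvr
  · exact main r p hpq.symm hvp (fun x hx => by have := hN x hx; tauto) hcq hcp hvr

/-- Each component that contains a neighbour of `z` is a single edge. Since `z` has at least four
neighbours, they are the four ends of the two edges; each end has degree three with its third
neighbour in the other component. -/
theorem IsIrreducible.constraintWheel [Finite V] (hC : C.IsIrreducible) {K K' : Set V}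
    (hK : C.IsComponent K) (hK' : C.IsComponent K') (hd : ∀ x ∈ K, x ∉ K')
    (hX : ∀ x y, C.constraintGraph.Adj x y → x ∈ K ∨ x ∈ K') {z a : V} (hzK : z ∉ K)
    (hzK' : z ∉ K') (hza : C.graph.Adj z a) (ha : a ∈ K) :
    constraintWheel.IsConstraintMinorOf C := by
  have hz : ∀ x, ¬ C.constraintGraph.Adj z x := fun x h => by
    have := hX z x h
    tauto
  have h5 : ∀ p q r s : V, ∃ x, x ≠ p ∧ x ≠ q ∧ x ≠ r ∧ x ≠ s := by
    obtain ⟨a, ha, b, hb, hab⟩ := hK.exists_adj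
    obtain ⟨c, hc, d, hd, hcd⟩ := hK'.exists_adj
    refine exists_ne_of_five (a := a) (b := b) (c := c) (d := d) (e := z) ?_
    have := hab.ne
    have := hcd.ne
    simp only [List.nodup_cons, List.mem_cons, List.not_mem_nil, or_false, not_or,
      not_false_eq_true, List.nodup_nil, and_true]
    grind
  have hd' : ∀ x ∈ K', x ∉ K := fun x h h' => hd x h' h
  have key := fun v => hC.adj_structure h5 hK hK' hd hzK hzK' hz (v := v)
  have key' := fun v => hC.adj_structure h5 hK' hK hd' hzK' hzK hz (v := v)
  obtain ⟨-, hdeg, ha1⟩ := key a hza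
  obtain ⟨b, qa, hab, hqa, haqa, hKab, hNa⟩ := ha1 ha
  have hb := hK.closed a ha b hab
  obtain ⟨x, hzx, hxa, hxb, -⟩ := hdeg b b
  have hxK' : x ∈ K' := by
    have := (key x hzx).1
    have := hKab x
    tauto
  obtain ⟨y, qx, hxy, hqx, hxqx, hKxy, hNx⟩ := (key' x hzx).2.2 hxK'
  have hyK' := hK'.closed x hxK' y hxy
  have hcases : ∀ w, C.graph.Adj z w → w = a ∨ w = b ∨ w = x ∨ w = y := by
    intro w hw
    have := (key w hw).1
    have := hKab w
    have := hKxy w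
    tauto
  have hzb : C.graph.Adj z b := by
    obtain ⟨w, hw, h1, h2, h3⟩ := hdeg x y
    have := hcases w hw
    grind
  have hzy : C.graph.Adj z y := by
    obtain ⟨w, hw, h1, h2, h3⟩ := hdeg x b
    have := hcases w hw
    grind
  obtain ⟨a', qb, hba, hqb, hbqb, hKba, hNb⟩ := (key b hzb).2.2 hb
  obtain ⟨x', qy, hyx, hqy, hyqy, hKyx, hNy⟩ := (key' y hzy).2.2 hyK'
  have hab_ne := hab.ne
  have hxy_ne := hxy.ne
  have hzne : z ≠ a ∧ z ≠ b ∧ z ≠ x ∧ z ≠ y := ⟨hza.ne, hzb.ne, hzx.ne, hzy.ne⟩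
  have hKK : a ≠ x ∧ a ≠ y ∧ b ≠ x ∧ b ≠ y := by grind
  obtain rfl : a' = a := by
    have := hKba a ha
    tauto
  obtain rfl : x' = x := by
    have := hKyx x hxK'
    tauto
  -- No edge leaves these five vertices, so there are no others.
  have hcov : ∀ v, v = b ∨ v = a' ∨ v = x' ∨ v = y ∨ v = z := by
    intro v
    have := hC.triConn.2 {b, a', x', y, z} z z ⟨z, by simp⟩ ?_ v
    · simp only [Set.mem_insert_iff, Set.mem_singleton_iff] at this
      tauto
    · have h1 := hKab qx hqx
      have h2 := hKab qy hqy
      have h3 := hKxy qa hqa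
      have h4 := hKxy qb hqb
      intro p hp q hpq
      left
      simp only [Set.mem_insert_iff, Set.mem_singleton_iff] at hp ⊢
      rcases hp with rfl | rfl | rfl | rfl | rfl
      · have := hNb q hpq
        grind
      · have := hNa q hpq
        grind
      · have := hNx q hpq
        grind
      · have := hNy q hpq
        grind
      · have := hcases q hpq
        grind
  have hX' : ∀ p q, C.constraintGraph.Adj p q → s(p, q) = s(a', b) ∨ s(p, q) = s(x', y) := by
    intro p q hpq
    have h1 := hpq.ne
    simp only [Sym2.eq_iff]
    rcases hX p q hpq with h | h
    · have h2 := hKab p h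
      have h3 := hKab q (hK.closed p h q hpq)
      grind
    · have h2 := hKxy p h
      have h3 := hKxy q (hK'.closed p h q hpq)
      grind
  have hX'' : ∀ p q, C.constraintGraph.Adj p q → s(p, q) = s(a', b) ∨ s(p, q) = s(y, x') := by
    intro p q hpq
    rw [Sym2.eq_swap (a := y)]
    exact hX' p q hpq
  have hnd : [b, a', x', y, z].Nodup := by
    simp only [List.nodup_cons, List.mem_cons, List.not_mem_nil, or_false, not_or,
      not_false_eq_true, List.nodup_nil, and_true]
    grind
  have hnd' : [b, a', y, x', z].Nodup := by
    simp only [List.nodup_cons, List.mem_cons, List.not_mem_nil, or_false, not_or,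
      not_false_eq_true, List.nodup_nil, and_true]
    grind
  -- `x'` and `y` have one neighbour across each, so the edges across form a matching; naming the
  -- end of the one at `a'` fixes the order of the rim.
  rcases hKxy qa hqa with rfl | rfl
  · refine constraintWheel_isConstraintMinorOf hcov hnd hab hxy hX' haqa ?_ hza hzb hzx hzy
    have h1 := hNx a' haqa.symm
    rcases hKxy qb hqb with rfl | rfl
    · have h2 := hNx b hbqb.symm
      grind
    · exact hbqb
  · refine constraintWheel_isConstraintMinorOf (fun v => by have := hcov v; tauto) hnd' hab hyx hX''
      haqa ?_ hza hzb hzy hzx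
    have h1 := hNy a' haqa.symm
    rcases hKxy qb hqb with rfl | rfl
    · exact hbqb
    · have h2 := hNy b hbqb.symm
      grind

theorem IsIrreducible.hasObstruction [Finite V] (hC : C.IsIrreducible) {K K' : Set V}
    (hK : C.IsComponent K) (hK' : C.IsComponent K') (hd : ∀ x ∈ K, x ∉ K') :
    C.HasObstruction := by
  have hX : ∀ x y, C.constraintGraph.Adj x y → x ∈ K ∨ x ∈ K' := by
    intro x y hxy
    by_contra! hx
    obtain ⟨L, hL, hxL⟩ := exists_isComponent hxy
    exact hC.false_of_three hK hK' hL hd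
      (fun w hw hwL => hx.1 (hL.subset_of_mem hK.closed hwL hw hxL))
      (fun w hw hwL => hx.2 (hL.subset_of_mem hK'.closed hwL hw hxL))
  by_cases hz : ∃ z, z ∉ K ∧ z ∉ K'
  · obtain ⟨z, hzK, hzK'⟩ := hz
    obtain ⟨k, hk⟩ := hK.connSet.1
    obtain ⟨w, hw, v, -, hv, hwv⟩ := (hC.triConn.connSet_univ z).exists_adj
      (Set.subset_univ {z | z ∉ K ∧ z ∉ K'}) ⟨z, hzK, hzK'⟩ (Set.mem_univ k) fun h => h.1 hk
    by_cases hvK : v ∈ K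
    · exact Or.inr (Or.inl (hC.constraintWheel hK hK' hd hX hw.1 hw.2 hwv hvK))
    · have hvK' : v ∈ K' := by
        by_contra h
        exact hv ⟨hvK, h⟩
      exact Or.inr (Or.inl (hC.constraintWheel hK' hK (fun x h h' => hd x h' h)
        (fun x y hxy => (hX x y hxy).symm) hw.2 hw.1 hwv hvK'))
  · push Not at hz
    have nontriv : ∀ L, C.IsComponent L → L.Nontrivial := fun L hL => by
      obtain ⟨a, ha, b, hb, hab⟩ := hL.exists_adj
      exact ⟨a, ha, b, hb, hab.ne⟩
    have hB : C.IsBipartition K K' := ⟨fun v => ⟨fun h h' => hd v h' h, hz v⟩, hK.connSet,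
      hK'.connSet, fun a ha b hb hab => hd b (hK.closed a ha b hab) hb⟩
    exact hB.hasObstruction hC.triConn (nontriv K hK) (nontriv K' hK')

/-- Contraction lowers the number of vertices without raising that of edges, and deletion lowers the
latter, so a graph without obstruction is irreducible by induction. Components of the constraint on
the two sides of the cut then yield one. -/
theorem hasObstruction_of_isConstraintCut [Finite V] (hC : C.graph.TriConn) {S : Set V}
    (hS : C.IsConstraintCut S) : C.HasObstruction := by
  induction hn : Nat.card V + C.graph.edgeSet.ncard using Nat.strong_induction_on
    generalizing V with
  | _ n ih =>
    subst hn
    by_contra hno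
    have hirr : C.IsIrreducible := by
      refine ⟨hC, fun u v huv hX hdel => ?_, fun u v huv hcon T hT hu hv hin hout => ?_⟩
      · refine hno (.of_deleteEdge (e := s(u, v)) huv hX
          (ih _ ?_ (C := C.deleteEdge s(u, v) hX) hdel (S := S) hS rfl))
        have : (C.deleteEdge s(u, v) hX).graph.edgeSet.ncard < C.graph.edgeSet.ncard :=
          SimpleGraph.ncard_edgeSet_deleteEdges_lt huv
        lia
      · obtain ⟨T', hT'⟩ := exists_isConstraintCut_contractEdge (u := u) (v := v) hT (by tauto)
          (by
            obtain ⟨a, ha, b, hb, hab⟩ := hin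
            refine ⟨a, ha, b, hab, fun he => ?_⟩
            rw [Sym2.eq_iff] at he
            grind) hout
        refine hno (.of_contractEdge (e := s(u, v)) huv
          (ih _ ?_ (C := C.contractEdge s(u, v)) hcon hT' rfl))
        have h1 : (C.contractEdge s(u, v)).graph.edgeSet.ncard ≤ C.graph.edgeSet.ncard :=
          SimpleGraph.ncard_edgeSet_contract_le _ _
        have h2 := SimpleGraph.card_contractVert_lt huv.ne
        lia
    obtain ⟨hcl, ⟨a, ha, b, hab⟩, ⟨c, hc, d, hcd⟩⟩ := hS
    obtain ⟨K, hK, haK⟩ := exists_isComponent hab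
    obtain ⟨K', hK', hcK'⟩ := exists_isComponent hcd
    refine hno (hirr.hasObstruction hK hK' fun x hx hx' => hc ?_)
    exact hK'.subset_of_mem hcl hx' (hK.subset_of_mem hcl haK ha hx) hcK'

end ConstraintGraph

/-! ### The characterisation -/

theorem theorem2p1 {V : Type*} [Finite V] (C : ConstraintGraph V)
    (hC : C.graph.IsKConnected 3) :
    C.IsConstraintConnected ↔
      ¬ (ConstraintGraph.constraintK4.IsConstraintMinorOf C ∨
        ConstraintGraph.constraintWheel.IsConstraintMinorOf C ∨
        ConstraintGraph.constraintPrism₁.IsConstraintMinorOf C ∨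
        ConstraintGraph.constraintPrism₂.IsConstraintMinorOf C ∨
        ConstraintGraph.constraintPrism₃.IsConstraintMinorOf C ∨
        ConstraintGraph.constraintPrism₄.IsConstraintMinorOf C) := by
  rw [C.isConstraintConnected_iff, not_iff_not]
  constructor
  · rintro ⟨S, hS⟩
    exact ConstraintGraph.hasObstruction_of_isConstraintCut hC.triConn hS
  · rintro (h | h | h | h | h | h)
    · exact h.exists_isConstraintCut ConstraintGraph.isConstraintCut_constraintK4
    · exact h.exists_isConstraintCut ConstraintGraph.isConstraintCut_constraintWheel
    · exact h.exists_isConstraintCut ConstraintGraph.isConstraintCut_constraintPrism₁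
    · exact h.exists_isConstraintCut ConstraintGraph.isConstraintCut_constraintPrism₂
    · exact h.exists_isConstraintCut ConstraintGraph.isConstraintCut_constraintPrism₃
    · exact h.exists_isConstraintCut ConstraintGraph.isConstraintCut_constraintPrism₄
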